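/- The following is a theorem of ZF (Zermelo--Fraenkel set theory without any form of the Axiom of Choice); equivalently, it holds in every model of ZF, all notions being interpreted in the model. An infinite set $X$ is *amorphous* if every subset of $X$ is finite or cofinite; it is *strongly rigid* if in every partition of $X$ into nonempty subsets all but finitely many cells are singletons; and it is *strongly amorphous* if it is amorphous and strongly rigid. Let $\ell^2(X)$ be the Hilbert space of all functions $\eta:X\to\mathbb{C}$ with $\sum_{x\in X}|\eta(x)|^2<\infty$ (the supremum of the sums over finite subsets), let $\mathcal{B}(\ell^2(X))$ be the algebra of bounded linear operators on it, and let $\mathcal{K}(\ell^2(X))$ be the set of compact operators, i.e. of the linear operators $T$ on $\ell^2(X)$ such that $T(A)$ is totally bounded for every bounded $A\subseteq\ell^2(X)$. A C*-algebra is *AF* if it has a system of finite-dimensional C*-subalgebras, directed by inclusion, whose union is norm-dense. **Proposition.** If $X$ is strongly amorphous, then $$\mathcal{B}(\ell^2(X))=\mathcal{K}(\ell^2(X))+\mathbb{C}1 .$$ Moreover, the Calkin algebra $\mathcal{Q}(\ell^2(X))=\mathcal{B}(\ell^2(X))/\mathcal{K}(\ell^2(X))$ is one-dimensional, and $\mathcal{B}(\ell^2(X))$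 is an AF algebra. -/

import Mathlib

/-!
The result is a theorem of ZF set theory, without any choice principle; in the presence of choice
there are no amorphous sets at all.  It is therefore stated for an arbitrary model `V` of ZF.
Every notion below is the notion in the sense of the model: all subsets, functions, families of
sets, real numbers and finite sets that are quantified over are elements of the model (or are coded
by elements of the model), never arbitrary sets or functions of the metatheory.
-/

namespace ZFModel

/-! ### Models of ZF -/

/-- The only symbol of the language of set theory, a binary relation symbol. -/
inductive MemSymbol : ℕ → Type
  | mem : MemSymbol 2

/-- The first-order language of set theory. -/
def setLanguage : FirstOrder.Language.{0, 0} := ⟨fun _ => Empty, MemSymbol⟩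

/-- A type with a membership relation is a structure for the language of set theory. -/
instance setStructure (V : Type*) [Membership V V] : setLanguage.Structure V where
  funMap f := nomatch f
  RelMap r := match r with
    | MemSymbol.mem => fun v => v 0 ∈ v 1

/-- `(V, ∈)` is a model of Zermelo--Fraenkel set theory.  In the two axiom schemes, the formulas
(with parameters from `V`) appear through the classes and class relations that they define. -/
class ZF (V : Type*) [Membership V V] : Prop where
  extensionality : ∀ a b : V, (∀ x : V, x ∈ a ↔ x ∈ b) → a = b
  foundation : ∀ a : V, (∃ x : V, x ∈ a) → ∃ x : V, x ∈ a ∧ ∀ y : V, y ∈ x → ¬ y ∈ a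
  pairing : ∀ a b : V, ∃ c : V, ∀ x : V, x ∈ c ↔ x = a ∨ x = b
  union : ∀ a : V, ∃ c : V, ∀ x : V, x ∈ c ↔ ∃ y : V, y ∈ a ∧ x ∈ y
  powerset : ∀ a : V, ∃ c : V, ∀ x : V, x ∈ c ↔ ∀ y : V, y ∈ x → y ∈ a
  infinity : ∃ w : V, (∃ e : V, e ∈ w ∧ ∀ x : V, ¬ x ∈ e) ∧
    ∀ x : V, x ∈ w → ∃ y : V, y ∈ w ∧ ∀ z : V, z ∈ y ↔ z ∈ x ∨ z = x
  separation : ∀ D : Set V, (Set.univ : Set V).Definable₁ setLanguage D →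
    ∀ a : V, ∃ c : V, ∀ x : V, x ∈ c ↔ x ∈ a ∧ x ∈ D
  replacement : ∀ F : Set (V × V), (Set.univ : Set V).Definable₂ setLanguage F →
    ∀ a : V, (∀ x : V, x ∈ a → ∃! y : V, (x, y) ∈ F) →
      ∃ c : V, ∀ y : V, y ∈ c ↔ ∃ x : V, x ∈ a ∧ (x, y) ∈ F

section Coding

variable {V : Type*} [Membership V V] [ZF V]

/-- The unordered pair `{a, b}` of the model. -/
noncomputable def upair (a b : V) : V := Classical.choose (ZF.pairing a b)

theorem mem_upair {a b x : V} : x ∈ upair a b ↔ x = a ∨ x = b :=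
  Classical.choose_spec (ZF.pairing a b) x

/-- The ordered pair `(a, b) = {{a}, {a, b}}` of the model. -/
noncomputable def opair (a b : V) : V := upair (upair a a) (upair a b)

theorem upair_inj_left {a b c : V} (h : upair a b = upair a c) : b = c := by
  have hb : b ∈ upair a c := h ▸ mem_upair.2 (Or.inr rfl)
  have hc : c ∈ upair a b := h ▸ mem_upair.2 (Or.inr rfl)
  rcases mem_upair.1 hb with hb | hb
  · rcases mem_upair.1 hc with hc | hc
    · rw [hb, hc]
    · exact hc.symm
  · exact hb

theorem opair_inj {a b c d : V} (h : opair a b = opair c d) : a = c ∧ b = d := by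
  have hac : a = c := by
    have h1 : upair c c ∈ opair a b := h ▸ mem_upair.2 (Or.inl rfl)
    rcases mem_upair.1 h1 with h1 | h1
    · have : a ∈ upair c c := h1 ▸ mem_upair.2 (Or.inl rfl)
      simpa using mem_upair.1 this
    · have : a ∈ upair c c := h1 ▸ mem_upair.2 (Or.inl rfl)
      simpa using mem_upair.1 this
  subst hac
  exact ⟨rfl, upair_inj_left (upair_inj_left h)⟩

end Coding

/-- The type of all elements of the set `a` of the model. -/
def El {V : Type*} [Membership V V] (a : V) : Type _ := {x : V // x ∈ a}

/-- A type whose elements are (coded by) elements of the model. -/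
class Coded (V : outParam (Type*)) (α : Type*) where
  code : α → V
  code_injective : Function.Injective code


open Coded

section Internal

variable {V : Type*} [Membership V V] [ZF V]

instance (a : V) : Coded V (El a) := ⟨Subtype.val, Subtype.val_injective⟩

noncomputable instance {α β : Type*} [Coded V α] [Coded V β] : Coded V (α × β) where
  code p := opair (code p.1) (code p.2)
  code_injective _ _ h :=
    Prod.ext (code_injective (opair_inj h).1) (code_injective (opair_inj h).2)

/-- `S` is a set of the model: its elements are exactly the elements of some `a` in `V`. -/
def IsSet {α : Type*} [Coded V α] (S : Set α) : Prop :=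
  ∃ a : V, ∀ z : V, z ∈ a ↔ ∃ s ∈ S, code s = z

/-- The subsets of `α` that belong to the model. -/
def ISet (α : Type*) [Coded V α] : Type _ := {S : Set α // IsSet S}

/-- The underlying set of a subset of `α` that belongs to the model. -/
def ISet.set {α : Type*} [Coded V α] (S : ISet α) : Set α := S.1

noncomputable instance {α : Type*} [Coded V α] : Coded V (ISet α) where
  code S := Classical.choose S.2
  code_injective S T h := by
    have h : Classical.choose S.2 = Classical.choose T.2 := h
    have hS := Classical.choose_spec S.2
    have hT := Classical.choose_spec T.2
    refine Subtype.ext (Set.ext fun x => ⟨fun hx => ?_, fun hx => ?_⟩)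
    · obtain ⟨y, hy, hyx⟩ := (hT (code x)).1 (h ▸ (hS (code x)).2 ⟨x, hx, rfl⟩)
      exact code_injective hyx ▸ hy
    · obtain ⟨y, hy, hyx⟩ := (hS (code x)).1 (h.symm ▸ (hT (code x)).2 ⟨x, hx, rfl⟩)
      exact code_injective hyx ▸ hy

/-- The functions from `α` to `β` that belong to the model, as sets of ordered pairs. -/
def IFun (α β : Type*) [Coded V α] [Coded V β] : Type _ :=
  {f : α → β // IsSet {p : α × β | p.2 = f p.1}}

/-- The graph of a function that belongs to the model. -/
def IFun.graph {α β : Type*} [Coded V α] [Coded V β] (f : IFun α β) : ISet (α × β) :=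
  ⟨{p | p.2 = f.1 p.1}, f.2⟩

instance {α β : Type*} [Coded V α] [Coded V β] : CoeFun (IFun α β) (fun _ => α → β) :=
  ⟨Subtype.val⟩

noncomputable instance {α β : Type*} [Coded V α] [Coded V β] : Coded V (IFun α β) where
  code f := code f.graph
  code_injective f g h := by
    have h1 : {p : α × β | p.2 = f.1 p.1} = {p : α × β | p.2 = g.1 p.1} :=
      congrArg ISet.set (code_injective (h : code f.graph = code g.graph))
    refine Subtype.ext (funext fun x => ?_)
    have h2 : (x, f.1 x) ∈ {p : α × β | p.2 = g.1 p.1} := h1 ▸ rfl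
    exact h2

/-! ### Finite sets, amorphous sets -/

/-- `S` is a finite set of the model: it belongs to every family of sets of the model that contains
the empty set and is closed under adding one element. -/
def IsFin {α : Type*} [Coded V α] (S : Set α) : Prop :=
  ∃ F : ISet α, F.set = S ∧ ∀ P : Set (ISet α), IsSet P →
    (∀ E : ISet α, E.set = ∅ → E ∈ P) →
    (∀ (G G' : ISet α) (x : α), G ∈ P → G'.set = insert x G.set → G' ∈ P) → F ∈ P

/-- `X` is amorphous: it is infinite, and each of its subsets is finite or cofinite. -/
def IsAmorphous (X : V) : Prop :=
  ¬ IsFin (Set.univ : Set (El X)) ∧ ∀ S : Set (El X), IsSet S → IsFin S ∨ IsFin Sᶜ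

/-- `X` is strongly rigid: it is infinite, and in any partition of `X` into nonempty subsets, all
but finitely many cells are singletons. -/
def IsStronglyRigid (X : V) : Prop :=
  ¬ IsFin (Set.univ : Set (El X)) ∧
    ∀ P : Set (ISet (El X)), IsSet P → (∀ A ∈ P, A.set.Nonempty) →
      (∀ A ∈ P, ∀ B ∈ P, A ≠ B → Disjoint A.set B.set) → (∀ x, ∃ A ∈ P, x ∈ A.set) →
      IsFin {A ∈ P | ¬ ∃ x, A.set = {x}}

/-- `X` is strongly amorphous: it is amorphous and strongly rigid. -/
def IsStronglyAmorphous (X : V) : Prop := IsAmorphous X ∧ IsStronglyRigid X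

/-- `s` is the sum of `f` over the finite set `F`: the pairs `(F, s)` form the least relation that
contains `(∅, 0)` and, with `(G, t)`, contains `(G ∪ {x}, t + f x)` for all `x ∉ G`. -/
def IsFinSum {α M : Type*} [Coded V α] [Coded V M] [AddCommMonoid M] (f : α → M) (F : ISet α)
    (s : M) : Prop :=
  ∀ P : Set (ISet α × M), IsSet P →
    (∀ E : ISet α, E.set = ∅ → (E, 0) ∈ P) →
    (∀ (G G' : ISet α) (x : α) (t : M), (G, t) ∈ P → x ∉ G.set → G'.set = insert x G.set →
      (G', t + f x) ∈ P) →
    (F, s) ∈ P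

end Internal

/-! ### Real and complex numbers -/

section Operators

variable {V : Type*} [Membership V V] [ZF V]

/-- The ordered field `R` is the field of real numbers of the model, i.e. its complete ordered field:
its operations and its order belong to the model, and every nonempty subset of `R` in the model which
is bounded above has a least upper bound. -/
structure IsRealField (R : V) [Field (El R)] [LinearOrder (El R)] [IsStrictOrderedRing (El R)] :
    Prop where
  add_isSet : IsSet {p : (El R × El R) × El R | p.2 = p.1.1 + p.1.2}
  mul_isSet : IsSet {p : (El R × El R) × El R | p.2 = p.1.1 * p.1.2}
  le_isSet : IsSet {p : El R × El R | p.1 ≤ p.2}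
  complete : ∀ S : Set (El R), IsSet S → S.Nonempty → BddAbove S → ∃ s, IsLUB S s

/-- The complex numbers `R[i]`, `i² = -1`, over the reals `R`. -/
abbrev Cplx (R : V) [Field (El R)] : Type _ := QuadraticAlgebra (El R) (-1) 0

noncomputable instance (R : V) [Field (El R)] : Coded V (Cplx R) where
  code z := opair (code z.re) (code z.im)
  code_injective _ _ h :=
    QuadraticAlgebra.ext (code_injective (opair_inj h).1) (code_injective (opair_inj h).2)

/-- `|z|²`. -/
def absSq {R : V} [Field (El R)] (z : Cplx R) : El R := z.re ^ 2 + z.im ^ 2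

/-! ### The Hilbert space `ℓ²(X)` -/

variable {X R : V} [Field (El R)] [LinearOrder (El R)]

/-- `∑ |f x|² ≤ b`, where the sum of a nonnegative function is the supremum of its sums over finite
subsets. -/
def SqSumLE (f : El X → Cplx R) (b : El R) : Prop :=
  ∀ (F : ISet (El X)) (s : El R), IsFinSum (fun x => absSq (f x)) F s → s ≤ b

/-- `‖f‖ ≤ c` in the `ℓ²`-norm. -/
def NormLE (f : El X → Cplx R) (c : El R) : Prop := 0 ≤ c ∧ SqSumLE f (c ^ 2)

variable (X R) in
/-- `ℓ²(X)`: the functions `η : X → ℂ` with `∑ |η x|² < ∞`. -/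
structure L2 where
  toIFun : IFun (El X) (Cplx R)
  summable : ∃ b : El R, SqSumLE toIFun.1 b

instance : CoeFun (L2 X R) (fun _ => El X → Cplx R) := ⟨fun η => η.toIFun.1⟩

noncomputable instance : Coded V (L2 X R) where
  code η := code η.toIFun
  code_injective η ζ h := by
    cases η; cases ζ; cases code_injective h; rfl

/-- `⟨η, ζ⟩ = c`: the finite sums of `η(x) conj(ζ(x))`, over the finite subsets of `X` directed by
inclusion, converge to `c`. -/
def IsInner (η ζ : L2 X R) (c : Cplx R) : Prop :=
  ∀ ε : El R, 0 < ε → ∃ F₀ : ISet (El X), IsFin F₀.set ∧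
    ∀ (F : ISet (El X)) (s : Cplx R), F₀.set ⊆ F.set → IsFinSum (fun x => η x * star (ζ x)) F s →
      absSq (s - c) ≤ ε

/-! ### Operators on `ℓ²(X)` -/

variable (X R) in
/-- The linear operators `ℓ²(X) → ℓ²(X)`. -/
structure Op where
  toIFun : IFun (L2 X R) (L2 X R)
  linear : ∀ (c : Cplx R) (η ζ θ : L2 X R), (∀ x, θ x = c * η x + ζ x) →
    ∀ x, toIFun.1 θ x = c * toIFun.1 η x + toIFun.1 ζ x

instance : CoeFun (Op X R) (fun _ => L2 X R → L2 X R) := ⟨fun T => T.toIFun.1⟩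

noncomputable instance : Coded V (Op X R) where
  code T := code T.toIFun
  code_injective S T h := by
    cases S; cases T; cases code_injective h; rfl

/-- `‖D‖ ≤ M` in the operator norm.  Here `D` may be a difference of two operators. -/
def OpNormLE (D : L2 X R → El X → Cplx R) (M : El R) : Prop :=
  0 ≤ M ∧ ∀ (η : L2 X R) (c : El R), NormLE η c → NormLE (D η) (M * c)

variable (X R) in
/-- `𝓑(ℓ²(X))`, the bounded linear operators on `ℓ²(X)`. -/
def boundedOps : Set (Op X R) := {T | ∃ M : El R, OpNormLE (fun η x => T η x) M}

/-- `A ⊆ ℓ²(X)` is bounded. -/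
def IsBdd (A : Set (L2 X R)) : Prop := ∃ c : El R, ∀ η ∈ A, NormLE η c

/-- `A ⊆ ℓ²(X)` is totally bounded: for each `ε > 0` it is covered by finitely many `ε`-balls. -/
def IsTotBdd (A : Set (L2 X R)) : Prop :=
  ∀ ε : El R, 0 < ε → ∃ F : Set (L2 X R), IsFin F ∧
    ∀ η ∈ A, ∃ ζ ∈ F, NormLE (fun x => η x - ζ x) ε

variable (X R) in
/-- `𝓚(ℓ²(X))`, the compact operators on `ℓ²(X)`: the linear operators that map bounded sets to
totally bounded sets. -/
def compactOps : Set (Op X R) :=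
  {T | ∀ A : Set (L2 X R), IsSet A → IsBdd A → IsTotBdd ((fun η => T η) '' A)}

variable (X R) in
/-- `𝓚(ℓ²(X)) + ℂ1`. -/
def compactAddScalar : Set (Op X R) :=
  {T | ∃ K ∈ compactOps X R, ∃ c : Cplx R, ∀ (η : L2 X R) (x : El X), T η x = K η x + c * η x}

/-! ### The Calkin algebra -/

/-- The coset `T + 𝓚(ℓ²(X))`. -/
def coset (T : Op X R) : Set (Op X R) :=
  {S | ∃ K ∈ compactOps X R, ∀ (η : L2 X R) (x : El X), S η x = T η x + K η x}

variable (X R) in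
/-- The Calkin algebra `𝓠(ℓ²(X)) = 𝓑(ℓ²(X)) / 𝓚(ℓ²(X))`, the set of cosets of bounded operators. -/
def Calkin : Type _ := {q : Set (Op X R) // ∃ T ∈ boundedOps X R, q = coset T}

/-- `q = c p` in the Calkin algebra. -/
def Calkin.IsSMul (c : Cplx R) (p q : Calkin X R) : Prop :=
  ∃ S ∈ p.1, ∃ T ∈ q.1, ∀ (η : L2 X R) (x : El X), T η x = c * S η x

variable (X R) in
/-- The Calkin algebra is one-dimensional: it has an element `e` different from its zero element
`𝓚(ℓ²(X))` such that every element is a scalar multiple of `e`. -/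
def CalkinOneDimensional : Prop :=
  ∃ e : Calkin X R, e.1 ≠ compactOps X R ∧ ∀ q : Calkin X R, ∃ c : Cplx R, Calkin.IsSMul c e q

/-! ### AF algebras -/

/-- `T` is the adjoint of `S`: `⟨S η, ζ⟩ = ⟨η, T ζ⟩` for all `η` and `ζ`. -/
def IsAdjoint (S T : Op X R) : Prop :=
  ∀ (η ζ : L2 X R) (c : Cplx R), IsInner (S η) ζ c ↔ IsInner η (T ζ) c

/-- `W` is a linear subspace of the space of linear operators. -/
def IsSubspace (W : Set (Op X R)) : Prop :=
  (∃ Z ∈ W, ∀ (η : L2 X R) (x : El X), Z η x = 0) ∧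
    ∀ S ∈ W, ∀ T ∈ W, ∀ c : Cplx R, ∃ U ∈ W, ∀ (η : L2 X R) (x : El X), U η x = c * S η x + T η x

/-- `A` is a C*-subalgebra of `𝓑(ℓ²(X))`: a linear subspace of `𝓑(ℓ²(X))` closed under composition,
under adjoints, and in the norm topology. -/
structure IsCStarSubalgebra (A : Set (Op X R)) : Prop where
  bounded : A ⊆ boundedOps X R
  subspace : IsSubspace A
  mul : ∀ S ∈ A, ∀ T ∈ A, ∃ U ∈ A, ∀ η : L2 X R, U η = S (T η)
  adjoint : ∀ S ∈ A, ∃ T ∈ A, IsAdjoint S T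
  closed : ∀ T ∈ boundedOps X R,
    (∀ ε : El R, 0 < ε → ∃ S ∈ A, OpNormLE (fun η x => T η x - S η x) ε) → T ∈ A

/-- `A` is finite-dimensional: it is contained in the span of a finite subset, the span being the
least linear subspace that contains it. -/
def IsFinDim (A : Set (Op X R)) : Prop :=
  ∃ G ⊆ A, IsFin G ∧ ∀ W : Set (Op X R), IsSet W → IsSubspace W → G ⊆ W → A ⊆ W

/-- The algebra `B` of operators is an AF algebra: it is a C*-algebra, and it has a system `𝒜` of
finite-dimensional C*-subalgebras, directed by inclusion, whose union is dense in `B`. -/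
def IsAF (B : Set (Op X R)) : Prop :=
  IsCStarSubalgebra B ∧
    ∃ 𝒜 : Set (ISet (Op X R)), IsSet 𝒜 ∧ 𝒜.Nonempty ∧
      (∀ A ∈ 𝒜, A.set ⊆ B ∧ IsCStarSubalgebra A.set ∧ IsFinDim A.set) ∧
      (∀ A₁ ∈ 𝒜, ∀ A₂ ∈ 𝒜, ∃ A₃ ∈ 𝒜, A₁.set ⊆ A₃.set ∧ A₂.set ⊆ A₃.set) ∧
      ∀ T ∈ B, ∀ ε : El R, 0 < ε →
        ∃ A ∈ 𝒜, ∃ S ∈ A.set, OpNormLE (fun η x => T η x - S η x) ε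

end Operators

end ZFModel

/-! On an amorphous set every real function is constant off a finite set. Its sublevel sets form a
chain, and a chain of finite subsets of an amorphous set has finite union: otherwise the parity of
the stage at which a point enters would split the set into two infinite pieces. The constant is the
supremum of the `r` for which `{f ≤ r}` is finite (`IsAmorphous.exists_isFin_ne`). Hence vectors of
`ℓ²(X)` have finite support, so all columns of the matrix of an operator are finite. The rows of a
bounded operator are finite too: otherwise a row has a constant entry `d ≠ 0` at cofinitely many
places, and testing on the indicator of `n` of them, of norm `√n`, gives `|d| n ≤ M √n` for
arbitrarily large `n` (`IsAmorphous.isFin_row`).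

Join `x` and `y` when the matrix of a bounded `T` has a nonzero entry at `(x, y)` or `(y, x)`. This
graph is locally finite, so its components are unions of chains of finite balls and therefore
finite. Strong rigidity, applied to the partition into components, leaves only finitely many
nontrivial ones (`IsStronglyAmorphous.isFin_nonisolated`). So off a finite set the matrix is
diagonal, and the diagonal is itself constant off a finite set: `T` is `c1` plus a finite matrix
(`IsStronglyAmorphous.exists_hasForm`). Finite matrices are compact, compact operators are bounded
and `1` is not compact; this gives the decomposition and the Calkin algebra. For finite `F` the
operators `c1` plus a matrix on `F × F` form a finite-dimensional C*-algebra; these algebras are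
directed and their union is everything.

All of this takes place inside the model: separation and induction over finite sets are available
only for predicates that belong to the model. The classes `Dfn`, `Pred` and `Internal` carry this
information and are closed under the logical operations, so that instance search supplies it.
Natural numbers of the model are never introduced: cardinalities are sums of ones in the real field,
parity is a sum of ones modulo 2, and iteration is replaced by least closed families. -/

namespace ZFModel

set_option linter.unusedSectionVars false
set_option synthInstance.maxSize 100000
set_option synthInstance.maxHeartbeats 1000000
set_option maxHeartbeats 1000000

open Coded

/-! ### Definable predicates of the model -/

section Definability

open FirstOrder FirstOrder.Language

variable {V : Type*} [Membership V V] {n : ℕ}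

/-- `P` is definable with parameters. -/
class Dfn (P : (Fin n → V) → Prop) : Prop where
  out : (Set.univ : Set V).Definable setLanguage {v | P v}

/-- `t` is a variable or a parameter. -/
class Tm (t : (Fin n → V) → V) : Prop where
  out : ∃ τ : (setLanguage[[(Set.univ : Set V)]]).Term (Fin n), ∀ v, τ.realize v = t v

instance Tm.var (i : Fin n) : Tm (V := V) fun v => v i := ⟨Term.var i, fun _ => rfl⟩

instance Tm.const (a : V) : Tm fun _ : Fin n → V => a :=
  ⟨(setLanguage.con (⟨a, trivial⟩ : (Set.univ : Set V))).term, fun v => by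
    rw [Term.realize_constants]; rfl⟩

instance (priority := high) Dfn.const (p : Prop) : Dfn fun _ : Fin n → V => p := by
  by_cases hp : p
  · exact ⟨by simp [hp]⟩
  · exact ⟨by simp [hp]⟩

instance Dfn.mem {s t : (Fin n → V) → V} [Tm s] [Tm t] : Dfn fun v => s v ∈ t v := by
  obtain ⟨σ, hσ⟩ := Tm.out (t := s)
  obtain ⟨τ, hτ⟩ := Tm.out (t := t)
  refine ⟨Relations.formula₂ (L := setLanguage[[(Set.univ : Set V)]])
    (Sum.inl MemSymbol.mem) σ τ, Set.ext fun v => ?_⟩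
  rw [Set.mem_ofPred_eq, ← hσ v, ← hτ v]
  refine Iff.trans ?_ (Formula.realize_rel₂ (L := setLanguage[[(Set.univ : Set V)]])
    (R := Sum.inl MemSymbol.mem)).symm
  rfl

instance Dfn.eq {s t : (Fin n → V) → V} [Tm s] [Tm t] : Dfn fun v => s v = t v := by
  obtain ⟨σ, hσ⟩ := Tm.out (t := s)
  obtain ⟨τ, hτ⟩ := Tm.out (t := t)
  refine ⟨Term.equal σ τ, Set.ext fun v => ?_⟩
  simp only [Set.mem_ofPred_eq, Formula.realize_equal, hσ, hτ]

instance Dfn.and {P Q : (Fin n → V) → Prop} [hP : Dfn P] [hQ : Dfn Q] : Dfn fun v => P v ∧ Q v :=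
  ⟨hP.out.inter hQ.out⟩

instance Dfn.or {P Q : (Fin n → V) → Prop} [hP : Dfn P] [hQ : Dfn Q] : Dfn fun v => P v ∨ Q v :=
  ⟨hP.out.union hQ.out⟩

instance Dfn.not {P : (Fin n → V) → Prop} [hP : Dfn P] : Dfn fun v => ¬ P v :=
  ⟨hP.out.compl⟩

theorem Dfn.congr {P Q : (Fin n → V) → Prop} (hP : Dfn P) (h : ∀ v, P v ↔ Q v) : Dfn Q := by
  have : P = Q := funext fun v => propext (h v)
  exact this ▸ hP

instance Dfn.imp {P Q : (Fin n → V) → Prop} [Dfn P] [Dfn Q] : Dfn fun v => P v → Q v :=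
  (inferInstance : Dfn fun v => ¬ P v ∨ Q v).congr fun _ => imp_iff_not_or.symm

instance Dfn.iff {P Q : (Fin n → V) → Prop} [Dfn P] [Dfn Q] : Dfn fun v => P v ↔ Q v :=
  (inferInstance : Dfn fun v => (P v → Q v) ∧ (Q v → P v)).congr fun _ => iff_def.symm

instance Dfn.ex {Q : (Fin n → V) → V → Prop}
    [h : Dfn fun v : Fin (n + 1) → V => Q (fun i => v i.castSucc) (v (Fin.last n))] :
    Dfn fun v => ∃ w, Q v w := by
  refine ⟨?_⟩
  -- The bound variable is the last coordinate, so quantifying over it is projecting along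
  -- `Fin.castSucc`.
  convert! h.out.image_comp (Fin.castSucc : Fin n → Fin (n + 1)) using 1
  ext v
  constructor
  · rintro ⟨w, hw⟩
    refine ⟨Fin.snoc v w, ?_, ?_⟩
    · simpa using hw
    · ext i; simp
  · rintro ⟨u, hu, rfl⟩
    exact ⟨_, hu⟩

instance Dfn.all {Q : (Fin n → V) → V → Prop}
    [h : Dfn fun v : Fin (n + 1) → V => Q (fun i => v i.castSucc) (v (Fin.last n))] :
    Dfn fun v => ∀ w, Q v w :=
  (inferInstance : Dfn fun v => ¬ ∃ w, ¬ Q v w).congr fun _ => by simp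

variable [ZF V]

theorem eq_upair_iff {a b c : V} : c = upair a b ↔ ∀ x, x ∈ c ↔ x = a ∨ x = b :=
  ⟨fun h x => h ▸ mem_upair, fun h => ZF.extensionality _ _ fun x => by rw [h x, mem_upair]⟩

/-- Pairs are not terms of the language, so `t` and `u` are only required to have definable graphs.
This lets nested pairs be unfolded recursively. -/
instance Dfn.upair {s t u : (Fin n → V) → V} [Tm s]
    [Dfn fun v : Fin (n + 1) → V => v (Fin.last n) ∈ s (fun i => v i.castSucc)]
    [Dfn fun v : Fin (n + 1) → V => v (Fin.last n) = t (fun i => v i.castSucc)]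
    [Dfn fun v : Fin (n + 1) → V => v (Fin.last n) = u (fun i => v i.castSucc)] :
    Dfn fun v => s v = ZFModel.upair (t v) (u v) :=
  (inferInstance : Dfn fun v => ∀ x, x ∈ s v ↔ x = t v ∨ x = u v).congr fun _ =>
    eq_upair_iff.symm

instance Dfn.opair {s t u : (Fin n → V) → V} [Tm s]
    [Dfn fun v : Fin (n + 1) → V => v (Fin.last n) ∈ s fun i => v i.castSucc]
    [Dfn fun v : Fin (n + 1) → V => v (Fin.last n) = ZFModel.upair (t fun i => v i.castSucc)
      (t fun i => v i.castSucc)]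
    [Dfn fun v : Fin (n + 1) → V => v (Fin.last n) = ZFModel.upair (t fun i => v i.castSucc)
      (u fun i => v i.castSucc)] :
    Dfn fun v => s v = opair (t v) (u v) :=
  (inferInstance : Dfn fun v => ∀ x, x ∈ s v ↔ x = ZFModel.upair (t v) (t v) ∨ x = ZFModel.upair (t v) (u v)).congr
    fun _ => eq_upair_iff.symm

end Definability

theorem exists_sep {V : Type*} [Membership V V] [ZF V] (a : V) (P : V → Prop)
    [h : Dfn fun v : Fin 1 → V => P (v 0)] : ∃ c : V, ∀ x, x ∈ c ↔ x ∈ a ∧ P x :=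
  ZF.separation {x | P x} h.out a

/-! ### Sets and functions of the model -/

section Internal

variable {V : Type*} [Membership V V] [ZF V]
variable {α β γ : Type*} [Coded V α] [Coded V β] [Coded V γ]

/-- The elements of `α` form a set of the model. -/
class Small (α : Type*) {V : Type*} [Coded V α] [Membership V V] : Prop where
  out : ∃ u : V, ∀ z : V, z ∈ u ↔ ∃ a : α, code a = z

/-- The predicate `P` defines a set of the model. -/
class Pred (P : α → Prop) : Prop where
  out : IsSet {a | P a}

/-- The function `f` belongs to the model. -/
class Internal (f : α → β) : Prop where
  out : IsSet {p : α × β | p.2 = f p.1}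

theorem IsSet.exists_code {S : Set α} (h : IsSet S) : ∃ s : V, (∀ a, code a ∈ s ↔ a ∈ S) ∧
    ∀ z, z ∈ s → ∃ a : α, code a = z := by
  obtain ⟨s, hs⟩ := h
  refine ⟨s, fun a => (hs _).trans ⟨fun ⟨b, hb, hab⟩ => code_injective hab ▸ hb,
    fun h => ⟨a, h, rfl⟩⟩, fun z hz => ?_⟩
  obtain ⟨a, -, ha⟩ := (hs z).1 hz
  exact ⟨a, ha⟩

/-- The graph of an internal function, as an element of the model. -/
theorem Internal.exists_graph {f : α → β} (h : Internal f) : ∃ g : V,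
    ∀ a w, opair (code a) w ∈ g ↔ w = code (f a) := by
  obtain ⟨s, hs, hs'⟩ := h.out.exists_code
  refine ⟨s, fun a w => ⟨fun hw => ?_, ?_⟩⟩
  · obtain ⟨⟨a', b⟩, hp⟩ := hs' _ hw
    obtain ⟨h1, rfl⟩ := opair_inj (hp : opair (code a') (code b) = _)
    rw [← hp] at hw
    have : b = f a' := (hs _).1 hw
    have h2 : a' = a := code_injective h1
    rw [← h2, ← this]
  · rintro rfl
    exact (hs (a, f a)).2 rfl

/-- The bridge from first-order definability to sets of the model: all codes of `α` form a set, and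
separation cuts out those that satisfy `Q`. -/
theorem isSet_of_dfn [Small α] {S : Set α} (Q : V → Prop) [Dfn fun v : Fin 1 → V => Q (v 0)]
    (h : ∀ a : α, Q (code a) ↔ a ∈ S) : IsSet S := by
  obtain ⟨u, hu⟩ := ‹Small α›.out
  obtain ⟨c, hc⟩ := exists_sep u Q
  refine ⟨c, fun z => (hc z).trans ⟨?_, ?_⟩⟩
  · rintro ⟨hz, hQ⟩
    obtain ⟨a, rfl⟩ := (hu z).1 hz
    exact ⟨a, (h a).1 hQ, rfl⟩
  · rintro ⟨a, ha, rfl⟩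
    exact ⟨(hu _).2 ⟨a, rfl⟩, (h a).2 ha⟩

theorem Pred.of_dfn [Small α] {P : α → Prop} (Q : V → Prop) [Dfn fun v : Fin 1 → V => Q (v 0)]
    (h : ∀ a : α, Q (code a) ↔ P a) : Pred P := ⟨isSet_of_dfn Q h⟩

instance Small.el (a : V) : Small (El a) :=
  ⟨a, fun z => ⟨fun h => ⟨⟨z, h⟩, rfl⟩, by rintro ⟨x, rfl⟩; exact x.2⟩⟩

instance Small.prod [Small α] [Small β] : Small (α × β) := by
  obtain ⟨u, hu⟩ := ‹Small α›.out
  obtain ⟨v, hv⟩ := ‹Small β›.out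
  obtain ⟨w, hw⟩ := ZF.union (upair u v)
  -- Kuratowski pairs of elements of `u ∪ v` lie in the second power set of `u ∪ v`, so separation
  -- suffices.
  obtain ⟨p, hp⟩ := ZF.powerset w
  obtain ⟨q, hq⟩ := ZF.powerset p
  obtain ⟨c, hc⟩ := exists_sep q fun z => ∃ x y, x ∈ u ∧ y ∈ v ∧ z = opair x y
  refine ⟨c, fun z => (hc z).trans ⟨?_, ?_⟩⟩
  · rintro ⟨-, x, y, hx, hy, rfl⟩
    obtain ⟨a, rfl⟩ := (hu x).1 hx
    obtain ⟨b, rfl⟩ := (hv y).1 hy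
    exact ⟨(a, b), rfl⟩
  · rintro ⟨⟨a, b⟩, rfl⟩
    have ha : code a ∈ u := (hu _).2 ⟨a, rfl⟩
    have hb : code b ∈ v := (hv _).2 ⟨b, rfl⟩
    have haw : code a ∈ w := (hw _).2 ⟨u, mem_upair.2 (.inl rfl), ha⟩
    have hbw : code b ∈ w := (hw _).2 ⟨v, mem_upair.2 (.inr rfl), hb⟩
    refine ⟨(hq _).2 fun y hy => (hp _).2 fun x hx => ?_, code a, code b, ha, hb, rfl⟩
    rcases mem_upair.1 hy with rfl | rfl <;> rcases mem_upair.1 hx with rfl | rfl <;> assumption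

/-! ### Closure properties of predicates and functions of the model -/

section Predicates

theorem Pred.congr {P Q : α → Prop} (hP : Pred P) (h : ∀ a, P a ↔ Q a) : Pred Q := by
  have : P = Q := funext fun v => propext (h v)
  exact this ▸ hP

theorem Pred.of_isSet {S : Set α} (h : IsSet S) : Pred fun a => a ∈ S := ⟨h⟩

instance Pred.mem_set (S : ISet α) : Pred fun a => a ∈ S.set := ⟨S.2⟩

theorem Pred.exists_code {P : α → Prop} (h : Pred P) : ∃ s : V, (∀ a, code a ∈ s ↔ P a) ∧
    ∀ z, z ∈ s → ∃ a : α, code a = z := h.out.exists_code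

variable [Small α] [Small β]

instance (priority := high) Pred.const (p : Prop) : Pred fun _ : α => p :=
  Pred.of_dfn (fun _ => p) fun _ => Iff.rfl

instance Pred.and {P Q : α → Prop} [hP : Pred P] [hQ : Pred Q] : Pred fun a => P a ∧ Q a := by
  obtain ⟨s, hs, -⟩ := hP.exists_code
  obtain ⟨t, ht, -⟩ := hQ.exists_code
  exact Pred.of_dfn (fun z => z ∈ s ∧ z ∈ t) fun a => by rw [hs, ht]

instance Pred.not {P : α → Prop} [hP : Pred P] : Pred fun a => ¬ P a := by
  obtain ⟨s, hs, -⟩ := hP.exists_code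
  exact Pred.of_dfn (fun z => ¬ z ∈ s) fun a => by rw [hs]

instance Pred.or {P Q : α → Prop} [Pred P] [Pred Q] : Pred fun a => P a ∨ Q a :=
  (inferInstance : Pred fun a => ¬ (¬ P a ∧ ¬ Q a)).congr fun _ => by tauto

instance Pred.imp {P Q : α → Prop} [Pred P] [Pred Q] : Pred fun a => P a → Q a :=
  (inferInstance : Pred fun a => ¬ P a ∨ Q a).congr fun _ => imp_iff_not_or.symm

instance Pred.iff {P Q : α → Prop} [Pred P] [Pred Q] : Pred fun a => P a ↔ Q a :=
  (inferInstance : Pred fun a => (P a → Q a) ∧ (Q a → P a)).congr fun _ => iff_def.symm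

instance Pred.ex {Q : α → β → Prop} [h : Pred fun p : α × β => Q p.1 p.2] :
    Pred fun a => ∃ b, Q a b := by
  obtain ⟨s, hs, hs'⟩ := h.exists_code
  refine Pred.of_dfn (fun z => ∃ w y, y = opair z w ∧ y ∈ s) fun a => ⟨?_, ?_⟩
  · rintro ⟨w, y, rfl, hw⟩
    obtain ⟨p, hp⟩ := hs' _ hw
    rw [← hp, hs] at hw
    exact ⟨p.2, code_injective (opair_inj hp).1 ▸ hw⟩
  · rintro ⟨b, hb⟩
    exact ⟨code b, _, rfl, (hs (a, b)).2 hb⟩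

instance Pred.all {Q : α → β → Prop} [h : Pred fun p : α × β => Q p.1 p.2] :
    Pred fun a => ∀ b, Q a b :=
  (inferInstance : Pred fun a => ¬ ∃ b, ¬ Q a b).congr fun _ => by simp

instance Pred.eq {f g : α → β} [hf : Internal f] [hg : Internal g] : Pred fun a => f a = g a := by
  obtain ⟨s, hs⟩ := hf.exists_graph
  obtain ⟨t, ht⟩ := hg.exists_graph
  refine Pred.of_dfn (fun z => ∃ w, (∃ y, y = opair z w ∧ y ∈ s) ∧ ∃ y, y = opair z w ∧ y ∈ t)
    fun a => ?_
  simp only [exists_eq_left, hs, ht, code_injective.eq_iff]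

instance Pred.mem {f : α → β} {S : α → ISet β} [hf : Internal f] [hS : Internal S] :
    Pred fun a => f a ∈ (S a).set := by
  obtain ⟨s, hs⟩ := hf.exists_graph
  obtain ⟨t, ht⟩ := hS.exists_graph
  refine Pred.of_dfn (fun z => ∃ w u, (∃ y, y = opair z w ∧ y ∈ s) ∧ (∃ y, y = opair z u ∧ y ∈ t) ∧
    w ∈ u) fun a => ?_
  simp only [exists_eq_left, hs, ht]
  have key : code (f a) ∈ code (S a) ↔ f a ∈ (S a).set :=
    (Classical.choose_spec (S a).2 (code (f a))).trans
      ⟨fun ⟨b, hb, h⟩ => code_injective h ▸ hb, fun h => ⟨_, h, rfl⟩⟩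
  rw [← key]
  exact ⟨fun ⟨_, _, h1, h2, h⟩ => h1 ▸ h2 ▸ h, fun h => ⟨_, _, rfl, rfl, h⟩⟩

theorem Pred.comp {P : β → Prop} (hP : Pred P) {f : α → β} (hf : Internal f) :
    Pred fun a => P (f a) := by
  obtain ⟨s, hs⟩ := hf.exists_graph
  obtain ⟨t, ht, -⟩ := hP.exists_code
  refine Pred.of_dfn (fun z => ∃ w, (∃ y, y = opair z w ∧ y ∈ s) ∧ w ∈ t) fun a => ?_
  simp only [exists_eq_left, hs, ht]

variable [Small γ]

theorem Internal.of_dfn {f : α → β} (Q : V → V → Prop)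
    [Dfn fun v : Fin 3 → V => Q (v 1) (v 2)] (h : ∀ a b, Q (code a) (code b) ↔ b = f a) :
    Internal f := by
  have : Dfn fun v : Fin 3 → V => v 0 = opair (v 1) (v 2) ∧ Q (v 1) (v 2) := inferInstance
  have : Dfn fun v : Fin 1 → V => ∃ x y, v 0 = opair x y ∧ Q x y := Dfn.ex (h := Dfn.ex (h := this))
  refine ⟨isSet_of_dfn (fun z => ∃ x y, z = opair x y ∧ Q x y) fun ⟨a, b⟩ => ?_⟩
  refine Iff.trans ⟨?_, fun hQ => ⟨_, _, rfl, hQ⟩⟩ (h a b)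
  rintro ⟨x, y, hxy, hQ⟩
  obtain ⟨rfl, rfl⟩ := opair_inj (hxy : opair (code a) (code b) = _)
  exact hQ

instance (priority := high) Internal.const (b : β) : Internal fun _ : α => b :=
  Internal.of_dfn (fun _ y => y = code b) fun _ _ => code_injective.eq_iff

instance (priority := high) Internal.id : Internal fun a : α => a :=
  Internal.of_dfn (fun x y => y = x) fun _ _ => code_injective.eq_iff

instance Internal.fst {f : α → β × γ} [hf : Internal f] : Internal fun a => (f a).1 := by
  obtain ⟨s, hs⟩ := hf.exists_graph
  refine Internal.of_dfn (fun x y => ∃ p z, p = opair y z ∧ ∃ q, q = opair x p ∧ q ∈ s)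
    fun a b => ?_
  simp only [exists_eq_left, hs]
  refine ⟨?_, ?_⟩
  · rintro ⟨p, z, rfl, h⟩
    exact code_injective (opair_inj (h : _ = opair (code (f a).1) (code (f a).2))).1
  · rintro rfl
    exact ⟨_, _, rfl, rfl⟩

instance Internal.snd {f : α → β × γ} [hf : Internal f] : Internal fun a => (f a).2 := by
  obtain ⟨s, hs⟩ := hf.exists_graph
  refine Internal.of_dfn (fun x y => ∃ p z, p = opair z y ∧ ∃ q, q = opair x p ∧ q ∈ s)
    fun a b => ?_
  simp only [exists_eq_left, hs]
  refine ⟨?_, ?_⟩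
  · rintro ⟨p, z, rfl, h⟩
    exact code_injective (opair_inj (h : _ = opair (code (f a).1) (code (f a).2))).2
  · rintro rfl
    exact ⟨_, _, rfl, rfl⟩

instance Internal.prod_fst : Internal (Prod.fst : α × β → α) := Internal.fst (f := fun p => p)

instance Internal.prod_snd : Internal (Prod.snd : α × β → β) := Internal.snd (f := fun p => p)

instance (priority := low) Internal.pair {f : α → β} {g : α → γ} [hf : Internal f] [hg : Internal g] :
    Internal fun a => (f a, g a) := by
  obtain ⟨s, hs⟩ := hf.exists_graph
  obtain ⟨t, ht⟩ := hg.exists_graph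
  refine Internal.of_dfn (fun x y => ∃ z w, y = opair z w ∧ (∃ q, q = opair x z ∧ q ∈ s) ∧
    ∃ q, q = opair x w ∧ q ∈ t) fun a b => ?_
  simp only [exists_eq_left, hs, ht]
  refine ⟨?_, ?_⟩
  · rintro ⟨z, w, h, rfl, rfl⟩
    exact Prod.ext (code_injective (opair_inj h).1) (code_injective (opair_inj h).2)
  · rintro rfl
    exact ⟨_, _, rfl, rfl, rfl⟩

instance Internal.prod_mk (a : α) : Internal (Prod.mk a : β → α × β) :=
  Internal.pair (f := fun _ => a) (g := fun b => b)

theorem Internal.comp {g : β → γ} (hg : Internal g) {f : α → β} (hf : Internal f) :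
    Internal fun a => g (f a) := by
  obtain ⟨s, hs⟩ := hf.exists_graph
  obtain ⟨t, ht⟩ := hg.exists_graph
  refine Internal.of_dfn (fun x y => ∃ w, (∃ q, q = opair x w ∧ q ∈ s) ∧
    ∃ q, q = opair w y ∧ q ∈ t) fun a b => ?_
  simp only [exists_eq_left, hs, ht, code_injective.eq_iff]

theorem Internal.of_pred {f : α → β} (Q : α → β → Prop) [hQ : Pred fun p : α × β => Q p.1 p.2]
    (h : ∀ a b, Q a b ↔ b = f a) : Internal f :=
  ⟨(hQ.congr fun p => h p.1 p.2).out⟩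

/-! ### Sets and functions of the model form sets of the model -/

theorem ISet.ext {S T : ISet α} (h : ∀ a, a ∈ S.set ↔ a ∈ T.set) : S = T :=
  Subtype.ext (Set.ext h)

instance Small.iSet : Small (ISet α) := by
  obtain ⟨u, hu⟩ := ‹Small α›.out
  obtain ⟨p, hp⟩ := ZF.powerset u
  refine ⟨p, fun z => (hp z).trans ⟨fun h => ?_, ?_⟩⟩
  · have h1 : IsSet {a : α | code a ∈ z} := ⟨z, fun w => ⟨fun hw => ?_, ?_⟩⟩
    · refine ⟨⟨_, h1⟩, ZF.extensionality _ _ fun w => ?_⟩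
      refine (Classical.choose_spec h1 w).trans ⟨?_, fun hw => ?_⟩
      · rintro ⟨a, ha, rfl⟩
        exact ha
      · obtain ⟨a, rfl⟩ := (hu w).1 (h w hw)
        exact ⟨a, hw, rfl⟩
    · obtain ⟨a, rfl⟩ := (hu w).1 (h w hw)
      exact ⟨a, hw, rfl⟩
    · rintro ⟨a, ha, rfl⟩
      exact ha
  · rintro ⟨S, rfl⟩ w hw
    obtain ⟨a, -, rfl⟩ := (Classical.choose_spec S.2 w).1 hw
    exact (hu _).2 ⟨a, rfl⟩

/-- The subset defined by an internal predicate. -/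
def ISet.mk (P : α → Prop) [h : Pred P] : ISet α := ⟨{a | P a}, h.out⟩

@[simp] theorem ISet.mem_mk (P : α → Prop) [Pred P] (a : α) : a ∈ (ISet.mk P).set ↔ P a := Iff.rfl

theorem ISet.set_mk (P : α → Prop) [Pred P] : (ISet.mk P).set = {a | P a} := rfl

/-- A set-valued function has the graph `{(a, T) | ∀ b, b ∈ T ↔ b ∈ S a}`, by extensionality; so
only the membership relation has to be internal. -/
theorem Internal.iSet {S : α → ISet β} [h : Pred fun p : α × β => p.2 ∈ (S p.1).set] :
    Internal S :=
  have : Pred fun q : (α × ISet β) × β => q.2 ∈ (S q.1.1).set :=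
    h.comp (f := fun q : (α × ISet β) × β => (q.1.1, q.2)) inferInstance
  Internal.of_pred (fun a T => ∀ b, b ∈ T.set ↔ b ∈ (S a).set) fun _ _ =>
    ⟨fun h => ISet.ext h, fun h => h ▸ fun _ => Iff.rfl⟩

/-- A type whose codes are those of a set of the model of some other type. -/
theorem Small.of_code {α' : Type*} [Coded V α'] (ι : α' → β)
    (hι : ∀ a, code (ι a) = code a) (h : Pred fun b => ∃ a, ι a = b) : Small α' := by
  obtain ⟨s, hs⟩ := h.out
  refine ⟨s, fun z => (hs z).trans ⟨?_, ?_⟩⟩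
  · rintro ⟨_, ⟨a, rfl⟩, rfl⟩
    exact ⟨a, (hι a).symm⟩
  · rintro ⟨a, rfl⟩
    exact ⟨ι a, ⟨a, rfl⟩, hι a⟩

theorem Internal.of_code (ι : α → β) (hι : ∀ a, code (ι a) = code a) : Internal ι :=
  Internal.of_dfn (fun x y => y = x) fun a b => by rw [← hι a, code_injective.eq_iff]

theorem Internal.of_code_comp (ι : α → β) (hι : ∀ a, code (ι a) = code a) {f : γ → α}
    (h : Internal fun c => ι (f c)) : Internal f := by
  obtain ⟨s, hs⟩ := h.exists_graph
  refine Internal.of_dfn (fun x y => ∃ q, q = opair x y ∧ q ∈ s) fun a b => ?_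
  simp only [exists_eq_left, hs, hι, code_injective.eq_iff]

theorem IFun.ext {f g : IFun α β} (h : ∀ a, f.1 a = g.1 a) : f = g := Subtype.ext (funext h)

/-- The element of the model given by an internal function. -/
def IFun.mk (f : α → β) [h : Internal f] : IFun α β := ⟨f, h.out⟩

instance Small.iFun : Small (IFun α β) := by
  refine Small.of_code (IFun.graph : IFun α β → _) (fun _ => rfl) ?_
  -- Functions are the total single-valued relations among the subsets of `α × β`.
  refine (inferInstance : Pred fun G : ISet (α × β) => ∀ a, ∃ b, (a, b) ∈ G.set ∧
    ∀ b', (a, b') ∈ G.set → b' = b).congr fun G => ⟨fun h => ?_, ?_⟩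
  · choose f hf hf' using h
    have : {p : α × β | p.2 = f p.1} = G.set := Set.ext fun p =>
      ⟨fun h => by have := hf p.1; rwa [← (h : p.2 = f p.1)] at this, fun h => hf' p.1 p.2 h⟩
    exact ⟨⟨f, this ▸ G.2⟩, Subtype.ext this⟩
  · rintro ⟨f, rfl⟩ a
    exact ⟨f.1 a, rfl, fun b' h => h⟩

instance IFun.internal (f : IFun α β) : Internal f.1 := ⟨f.2⟩

instance Internal.graph {f : α → IFun β γ} [hf : Internal f] : Internal fun a => (f a).graph :=
  (Internal.of_code (IFun.graph : IFun β γ → _) fun _ => rfl).comp hf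

instance Internal.apply {f : α → IFun β γ} {x : α → β} [Internal f] [Internal x] :
    Internal fun a => (f a).1 (x a) :=
  have := Internal.comp ‹Internal x› (Internal.prod_fst (β := γ))
  have := Internal.comp ‹Internal f› (Internal.prod_fst (β := γ))
  Internal.of_pred (fun a c => (x a, c) ∈ (f a).graph.set) fun _ _ => Iff.rfl

theorem Internal.iFun {f : α → IFun β γ} (h : Internal fun p : α × β => (f p.1).1 p.2) :
    Internal f :=
  have : Internal fun q : (α × IFun β γ) × β => (f q.1.1).1 q.2 :=
    h.comp (f := fun q : (α × IFun β γ) × β => (q.1.1, q.2)) inferInstance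
  Internal.of_pred (fun a g => ∀ b, g.1 b = (f a).1 b) fun _ _ =>
    ⟨fun h => IFun.ext h, fun h => h ▸ fun _ => rfl⟩

open Classical in
instance Internal.ite {P : α → Prop} {f g : α → β} [Pred P] [Internal f] [Internal g] :
    Internal fun a => if P a then f a else g a :=
  have := Pred.comp ‹Pred P› (Internal.prod_fst (β := β))
  have := Internal.comp ‹Internal f› (Internal.prod_fst (β := β))
  have := Internal.comp ‹Internal g› (Internal.prod_fst (β := β))
  Internal.of_pred (fun a b => (P a ∧ b = f a) ∨ (¬ P a ∧ b = g a)) fun a b => by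
    by_cases h : P a <;> simp [h]

end Predicates

end Internal

section Finite

variable {V : Type*} [Membership V V] [ZF V]
variable {α β γ M : Type*} [Coded V α] [Coded V β] [Coded V γ] [Coded V M]
variable [Small α] [Small β] [Small γ] [Small M]

/-! ### Internal predicates about sets -/

/-- Turns a relation into an internal family of elements of the model. A statement with a parameter
can then be proved for all elements of `ISet β` at once and composed with the family. -/
theorem Pred.exists_curry {Q : α → β → Prop} (h : Pred fun p : α × β => Q p.1 p.2) :
    ∃ S : α → ISet β, Internal S ∧ ∀ a b, b ∈ (S a).set ↔ Q a b := by
  have h1 (a : α) : Pred fun b => Q a b := h.comp (f := fun b => (a, b)) inferInstance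
  refine ⟨fun a => ISet.mk (Q a), ?_, fun a b => Iff.rfl⟩
  have : Pred fun p : α × β => p.2 ∈ (ISet.mk (Q p.1)).set := h
  exact Internal.iSet

theorem Internal.exists_curry {f : α → β → γ} (h : Internal fun p : α × β => f p.1 p.2) :
    ∃ F : α → IFun β γ, Internal F ∧ ∀ a b, (F a).1 b = f a b := by
  have h1 (a : α) : Internal fun b => f a b := h.comp (f := fun b => (a, b)) inferInstance
  exact ⟨fun a => IFun.mk (f a), Internal.iFun h, fun a b => rfl⟩

section

variable {S T : α → Set β} {f g : α → β}

instance Pred.set_eq [Pred fun p : α × β => p.2 ∈ S p.1] [Pred fun p : α × β => p.2 ∈ T p.1] :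
    Pred fun a => S a = T a :=
  (inferInstance : Pred fun a => ∀ b, b ∈ S a ↔ b ∈ T a).congr fun _ => Set.ext_iff.symm

instance Pred.set_subset [Pred fun p : α × β => p.2 ∈ S p.1]
    [Pred fun p : α × β => p.2 ∈ T p.1] : Pred fun a => S a ⊆ T a :=
  (inferInstance : Pred fun a => ∀ b, b ∈ S a → b ∈ T a)

instance Pred.mem_insert [Internal f] [Internal g] [Pred fun a => f a ∈ S a] :
    Pred fun a => f a ∈ insert (g a) (S a) :=
  (inferInstance : Pred fun a => f a = g a ∨ f a ∈ S a)

instance Pred.mem_union [Pred fun a => f a ∈ S a] [Pred fun a => f a ∈ T a] :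
    Pred fun a => f a ∈ S a ∪ T a :=
  (inferInstance : Pred fun a => f a ∈ S a ∨ f a ∈ T a)

instance Pred.mem_univ : Pred (Membership.mem (Set.univ : Set β)) :=
  (inferInstance : Pred fun _ => True)

instance Pred.mem_insert' {S : Set β} {x : β} [Pred fun a => a ∈ S] :
    Pred (Membership.mem (insert x S)) :=
  Pred.mem_insert (f := fun b => b) (g := fun _ => x) (S := fun _ => S)

instance Pred.mem_setOf' {Q : β → Prop} [Pred Q] : Pred (Membership.mem {b | Q b}) := ‹_›

instance Pred.nonempty [Pred fun p : α × β => p.2 ∈ S p.1] : Pred fun a => (S a).Nonempty :=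
  (inferInstance : Pred fun a => ∃ b, b ∈ S a)

instance Pred.mem_setOf {Q : α → β → Prop} [Pred fun a => Q a (f a)] :
    Pred fun a => f a ∈ {b | Q a b} := ‹_›

end

/-! ### Finite sets -/

/-- The empty set. -/
def ISet.empty : ISet α := ISet.mk fun _ => False

/-- The set `F ∪ {x}`. -/
def ISet.insert (F : ISet α) (x : α) : ISet α := ISet.mk fun y => y ∈ Insert.insert x F.set

@[simp] theorem ISet.set_empty : (ISet.empty : ISet α).set = ∅ := rfl

@[simp] theorem ISet.set_insert (F : ISet α) (x : α) :
    (F.insert x).set = Insert.insert x F.set := rfl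

theorem ISet.set_injective {S T : ISet α} (h : S.set = T.set) : S = T := Subtype.ext h

instance Internal.iSet_insert {F : α → ISet β} {x : α → β} [Internal F] [Internal x] :
    Internal fun a => (F a).insert (x a) := by
  have : Internal fun p : ISet β × β => p.1.insert p.2 := by
    have : Pred fun p : (ISet β × β) × β => p.2 ∈ (p.1.1.insert p.1.2).set :=
      (inferInstance : Pred fun p : (ISet β × β) × β => p.2 = p.1.2 ∨ p.2 ∈ p.1.1.set)
    exact Internal.iSet
  exact this.comp (f := fun a => (F a, x a)) inferInstance

/-- Here the quantifier over families ranges over a type that is a set of the model, which makes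
finiteness itself an internal predicate. -/
theorem isFin_iff (F : ISet α) : IsFin F.set ↔ ∀ P : ISet (ISet α), ISet.empty ∈ P.set →
    (∀ (G : ISet α) (x : α), G ∈ P.set → G.insert x ∈ P.set) → F ∈ P.set := by
  constructor
  · rintro ⟨F', h, hF⟩ P h0 hs
    obtain rfl := ISet.set_injective h
    exact hF P.set P.2 (fun E hE => ISet.set_injective (T := E) (S := ISet.empty) hE.symm ▸ h0)
      fun G G' x hG h => ISet.set_injective (S := G.insert x) (T := G') h.symm ▸ hs G x hG
  · exact fun h => ⟨F, rfl, fun P hP h0 hs => h ⟨P, hP⟩ (h0 _ rfl) fun G x hG => hs G _ x hG rfl⟩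

theorem IsFin.exists_iSet {S : Set α} (h : IsFin S) : ∃ F : ISet α, F.set = S :=
  ⟨h.choose, h.choose_spec.1⟩

instance Pred.isFin {S : α → Set β} [h : Pred fun p : α × β => p.2 ∈ S p.1] :
    Pred fun a => IsFin (S a) := by
  obtain ⟨F, hF, hF'⟩ := h.exists_curry
  have h1 : S = fun a => (F a).set := funext fun a => Set.ext fun b => (hF' a b).symm
  subst h1
  have : Pred fun S : ISet β => IsFin S.set :=
    (inferInstance : Pred fun F : ISet β => ∀ P : ISet (ISet β), ISet.empty ∈ P.set →
      (∀ (G : ISet β) (x : β), G ∈ P.set → G.insert x ∈ P.set) → F ∈ P.set).congr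
      fun F => (isFin_iff F).symm
  exact this.comp hF

theorem IsFin.empty : IsFin (∅ : Set α) := (isFin_iff ISet.empty).2 fun _ h _ => h

theorem IsFin.insert {S : Set α} (h : IsFin S) (x : α) : IsFin (insert x S) := by
  obtain ⟨F, rfl⟩ := h.exists_iSet
  exact (isFin_iff (F.insert x)).2 fun P h0 hs => hs _ _ ((isFin_iff F).1 h P h0 hs)

theorem IsFin.singleton (x : α) : IsFin ({x} : Set α) := by
  simpa using (IsFin.empty (α := α)).insert x

/-- Finiteness speaks only about families in the model, so the induction predicate must define a set
of the model. -/
theorem ISet.induction {Φ : ISet α → Prop} [hΦ : Pred Φ] (h0 : Φ ISet.empty)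
    (hs : ∀ (G : ISet α) (x : α), IsFin G.set → x ∉ G.set → Φ G → Φ (G.insert x))
    {F : ISet α} (hF : IsFin F.set) : Φ F := by
  have := (isFin_iff F).1 hF (ISet.mk fun G => IsFin G.set ∧ Φ G) ⟨IsFin.empty, h0⟩ ?_
  · exact this.2
  · rintro G x ⟨hG, h⟩
    refine ⟨hG.insert x, ?_⟩
    by_cases hx : x ∈ G.set
    · have : G.insert x = G := ISet.set_injective (Set.insert_eq_of_mem hx)
      rwa [this]
    · exact hs G x hG hx h

theorem IsFin.induction {Φ : Set α → Prop} [Pred fun F : ISet α => Φ F.set] (h0 : Φ ∅)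
    (hs : ∀ (G : ISet α) (x : α), IsFin G.set → x ∉ G.set → Φ G.set → Φ (Insert.insert x G.set))
    {S : Set α} (hS : IsFin S) : Φ S := by
  obtain ⟨F, rfl⟩ := hS.exists_iSet
  exact ISet.induction (Φ := fun F => Φ F.set) h0 hs hS

theorem IsFin.subset {S T : Set α} (hT : IsFin T) [hS : Pred fun a => a ∈ S] (h : S ⊆ T) :
    IsFin S := by
  -- Induction on the larger set, for all its subsets simultaneously: a subset of `F ∪ {x}` is
  -- handled by removing `x`.
  have key : ∀ G : ISet α, G.set ⊆ T → IsFin G.set := by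
    refine IsFin.induction (Φ := fun T => ∀ G : ISet α, G.set ⊆ T → IsFin G.set) ?_ ?_ hT
    · intro G hG
      rw [Set.subset_empty_iff.1 hG]
      exact IsFin.empty
    · intro F x _ hx ih G hG
      have h1 := ih (ISet.mk fun y => y ∈ G.set ∧ y ≠ x) fun y hy =>
        (hG hy.1).resolve_left hy.2
      by_cases hxG : x ∈ G.set
      · convert! h1.insert x using 1
        ext y
        by_cases hy : y = x <;> simp [hy, hxG, ISet.set_mk]
      · convert! h1 using 1
        ext y
        simp only [ISet.mem_mk]
        exact ⟨fun hy => ⟨hy, fun h => hxG (h ▸ hy)⟩, fun hy => hy.1⟩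
  exact key (ISet.mk fun a => a ∈ S) h

theorem IsFin.union {S T : Set α} (hS : IsFin S) (hT : IsFin T) : IsFin (S ∪ T) := by
  obtain ⟨F, rfl⟩ := hS.exists_iSet
  refine IsFin.induction (Φ := fun T => IsFin (F.set ∪ T)) (by simpa using hS) ?_ hT
  intro G x _ _ h
  rw [Set.union_insert]
  exact h.insert x

theorem IsFin.biUnion {S : Set α} (hS : IsFin S) {Q : α → β → Prop}
    [hQ : Pred fun p : α × β => Q p.1 p.2] (h : ∀ a ∈ S, IsFin {b | Q a b}) :
    IsFin {b | ∃ a ∈ S, Q a b} := by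
  obtain ⟨U, hU, hUQ⟩ := hQ.exists_curry
  have h' : ∀ a ∈ S, IsFin (U a).set := fun a ha => by
    convert! h a ha using 1
    ext b
    exact hUQ a b
  simp_rw [← hUQ]
  clear h hUQ hQ
  have := U
  obtain ⟨W, hW⟩ : ∃ W : IFun α (ISet β), W.1 = U := ⟨IFun.mk U, rfl⟩
  subst hW
  refine IsFin.induction (Φ := fun S => (∀ a ∈ S, IsFin (W.1 a).set) →
    IsFin {b | ∃ a ∈ S, b ∈ (W.1 a).set}) ?_ ?_ hS h'
  · intro _
    convert! (IsFin.empty (α := β)) using 1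
    ext; simp
  · intro G x _ _ ih h
    convert! (h x (Set.mem_insert _ _)).union (ih fun a ha => h a (Set.mem_insert_of_mem _ ha))
      using 1
    ext; simp

theorem IsFin.image {S : Set α} (hS : IsFin S) (f : α → β) [hf : Internal f] :
    IsFin {b | ∃ a ∈ S, b = f a} := by
  have : Pred fun p : α × β => p.2 = f p.1 := ⟨hf.out⟩
  refine hS.biUnion (Q := fun a b => b = f a) fun a _ => ?_
  exact IsFin.singleton (f a)

theorem IsFin.prod {S : Set α} {T : Set β} (hS : IsFin S) (hT : IsFin T) :
    IsFin {p : α × β | p.1 ∈ S ∧ p.2 ∈ T} := by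
  obtain ⟨F, rfl⟩ := hT.exists_iSet
  have := hS.biUnion (Q := fun (a : α) (p : α × β) => p.1 = a ∧ p.2 ∈ F.set) fun a _ => by
    convert! hT.image (fun b => (a, b)) using 1
    ext ⟨x, y⟩
    simp only [Set.mem_ofPred_eq, Prod.mk.injEq]
    exact ⟨fun ⟨h, h'⟩ => ⟨y, h', h, rfl⟩, fun ⟨b, hb, h, h'⟩ => ⟨h, h' ▸ hb⟩⟩
  convert! this using 1
  ext p
  simp

theorem IsFin.powerset {S : Set α} (hS : IsFin S) : IsFin {A : ISet α | A.set ⊆ S} := by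
  refine IsFin.induction (Φ := fun S => IsFin {A : ISet α | A.set ⊆ S}) ?_ ?_ hS
  · convert! IsFin.singleton (ISet.empty : ISet α) using 1
    ext A
    simp only [Set.mem_ofPred_eq, Set.subset_empty_iff, Set.mem_singleton_iff]
    exact ⟨fun h => ISet.set_injective h, fun h => h ▸ rfl⟩
  · intro G x _ _ ih
    -- Every subset of `G ∪ {x}` is `A` or `A ∪ {x}` with `A ⊆ G`.
    refine (ih.union (ih.image fun A => A.insert x)).subset fun A hA => ?_
    by_cases hx : x ∈ A.set
    · refine .inr ⟨ISet.mk fun y => y ∈ A.set ∧ y ≠ x, fun y hy => (hA hy.1).resolve_left hy.2, ?_⟩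
      refine ISet.ext fun y => ?_
      by_cases hy : y = x <;> simp [hy, hx]
    · exact .inl fun y hy => (hA hy).resolve_left fun h => hx (h ▸ hy)

/-- A nonempty family of finite sets has a minimal element. -/
theorem exists_minimal (𝓢 : ISet (ISet α)) (hfin : ∀ A ∈ 𝓢.set, IsFin A.set)
    (hne : 𝓢.set.Nonempty) : ∃ A ∈ 𝓢.set, ∀ B ∈ 𝓢.set, B.set ⊆ A.set → B = A := by
  obtain ⟨A, hA⟩ := hne
  have key : ∀ F : Set α, IsFin F → ∀ 𝓣 : ISet (ISet α), 𝓣.set.Nonempty →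
      (∀ B ∈ 𝓣.set, B.set ⊆ F) → ∃ B ∈ 𝓣.set, ∀ C ∈ 𝓣.set, C.set ⊆ B.set → C = B := by
    intro F hF
    refine IsFin.induction (Φ := fun F => ∀ 𝓣 : ISet (ISet α), 𝓣.set.Nonempty →
      (∀ B ∈ 𝓣.set, B.set ⊆ F) → ∃ B ∈ 𝓣.set, ∀ C ∈ 𝓣.set, C.set ⊆ B.set → C = B) ?_ ?_ hF
    · rintro 𝓣 ⟨B, hB⟩ h
      refine ⟨B, hB, fun C hC _ => ISet.set_injective ?_⟩
      rw [Set.subset_empty_iff.1 (h B hB), Set.subset_empty_iff.1 (h C hC)]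
    · rintro G x - hxG ih 𝓣 ⟨B, hB⟩ h
      -- If some member avoids `x`, a minimal one among those is minimal overall. Otherwise every
      -- member contains `x`, and the induction hypothesis applies after removing `x` from each.
      by_cases hx : ∃ B ∈ 𝓣.set, x ∉ B.set
      · obtain ⟨B, hB, hxB⟩ := hx
        obtain ⟨C, hC, hC'⟩ := ih (ISet.mk fun C => C ∈ 𝓣.set ∧ x ∉ C.set) ⟨B, hB, hxB⟩
          fun D hD y hy => (h D hD.1 hy).resolve_left fun h => hD.2 (h ▸ hy)
        exact ⟨C, hC.1, fun D hD hDC => hC' D ⟨hD, fun hx => hC.2 (hDC hx)⟩ hDC⟩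
      · push Not at hx
        have hrem (D : ISet α) (hD : D ∈ 𝓣.set) :
            (ISet.mk fun y => y ∈ D.set ∧ y ≠ x).insert x = D := ISet.ext fun y => by
          by_cases hy : y = x
          · simp [hy, hx D hD]
          · simp [hy]
        obtain ⟨C, hC, hC'⟩ := ih (ISet.mk fun C => C.insert x ∈ 𝓣.set ∧ x ∉ C.set)
          ⟨ISet.mk fun y => y ∈ B.set ∧ y ≠ x, by
            simp only [ISet.mem_mk]; rw [hrem B hB]; exact ⟨hB, fun h => h.2 rfl⟩⟩
          fun D hD y hy => (h _ hD.1 (.inr hy)).resolve_left fun h => hD.2 (h ▸ hy)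
        refine ⟨_, hC.1, fun D hD hDC => ?_⟩
        rw [← hrem D hD]
        congr 1
        refine hC' _ ⟨?_, fun h => h.2 rfl⟩ fun y hy => (hDC hy.1).resolve_left hy.2
        rw [hrem D hD]
        exact hD
  exact (key _ (hfin A hA) (ISet.mk fun B => B ∈ 𝓢.set ∧ B.set ⊆ A.set) ⟨A, hA, subset_rfl⟩
    fun B hB => hB.2).elim fun B ⟨hB, hB'⟩ => ⟨B, hB.1, fun C hC hCB =>
      hB' C ⟨hC, hCB.trans hB.2⟩ hCB⟩

/-! ### Finite sums -/

/-- The addition of `M` belongs to the model. -/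
class InternalAdd (M : Type*) {V : Type*} [Coded V M] [Membership V V] [ZF V] [Add M] : Prop where
  out : Internal fun p : M × M => p.1 + p.2

theorem Internal.add [Add M] [h : InternalAdd M] {f g : α → M} [Internal f] [Internal g] :
    Internal fun a => f a + g a :=
  h.out.comp (f := fun a => (f a, g a)) inferInstance

variable [AddCommMonoid M]

theorem isFinSum_iff {f : α → M} {F : ISet α} {s : M} : IsFinSum f F s ↔
    ∀ P : ISet (ISet α × M), (ISet.empty, 0) ∈ P.set →
      (∀ (G : ISet α) (x : α) (t : M), (G, t) ∈ P.set → x ∉ G.set →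
        (G.insert x, t + f x) ∈ P.set) → (F, s) ∈ P.set := by
  constructor
  · intro h P h0 hs
    exact h P.set P.2 (fun E hE => ISet.set_injective (T := E) (S := ISet.empty) hE.symm ▸ h0)
      fun G G' x t hG hx h => ISet.set_injective (S := G.insert x) (T := G') h.symm ▸ hs G x t hG hx
  · exact fun h P hP h0 hs => h ⟨P, hP⟩ (h0 _ rfl) fun G x t hG hx => hs G _ x t hG hx rfl

theorem isFinSum_empty (f : α → M) : IsFinSum f ISet.empty 0 :=
  isFinSum_iff.2 fun _ h _ => h

theorem IsFinSum.insert {f : α → M} {F : ISet α} {s : M} (h : IsFinSum f F s) {x : α}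
    (hx : x ∉ F.set) : IsFinSum f (F.insert x) (s + f x) :=
  isFinSum_iff.2 fun P h0 hs => hs _ _ _ (isFinSum_iff.1 h P h0 hs) hx

variable [InternalAdd M]

local instance (priority := low) Internal.add_of_addCommMonoid {f g : α → M} [Internal f] [Internal g] :
    Internal fun a => f a + g a := Internal.add

instance Pred.isFinSum {f : γ → α → M} {F : γ → ISet α} {s : γ → M}
    [hf : Internal fun p : γ × α => f p.1 p.2] [hF : Internal F] [hs : Internal s] :
    Pred fun c => IsFinSum (f c) (F c) (s c) := by
  obtain ⟨g, hg, hgf⟩ := hf.exists_curry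
  -- With `f` given by elements of the model, instance search can see that predicates quantifying
  -- over it are internal.
  obtain rfl : f = fun c => (g c).1 := funext fun c => funext fun a => (hgf c a).symm
  have : Pred fun q : IFun α M × ISet α × M => IsFinSum q.1.1 q.2.1 q.2.2 :=
    (inferInstance : Pred fun q : IFun α M × ISet α × M =>
      ∀ P : ISet (ISet α × M), (ISet.empty, 0) ∈ P.set →
      (∀ (G : ISet α) (x : α) (t : M), (G, t) ∈ P.set → x ∉ G.set →
        (G.insert x, t + q.1.1 x) ∈ P.set) → (q.2.1, q.2.2) ∈ P.set).congr
      fun _ => isFinSum_iff.symm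
  exact this.comp (f := fun c => (g c, F c, s c)) inferInstance

/-! ### Existence and uniqueness of finite sums -/

section Uniqueness

variable {f : α → M} [hf : Internal f]

theorem IsFinSum.induction {Φ : ISet α → M → Prop} [Pred fun p : ISet α × M => Φ p.1 p.2]
    (h0 : Φ ISet.empty 0) (hs : ∀ (G : ISet α) (x : α) (t : M), IsFinSum f G t → x ∉ G.set →
      Φ G t → Φ (G.insert x) (t + f x)) {F : ISet α} {s : M} (h : IsFinSum f F s) : Φ F s := by
  obtain ⟨g, rfl⟩ : ∃ g : IFun α M, g.1 = f := ⟨IFun.mk f, rfl⟩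
  exact (isFinSum_iff.1 h (ISet.mk fun p => IsFinSum g.1 p.1 p.2 ∧ Φ p.1 p.2)
    ⟨isFinSum_empty _, h0⟩ fun G x t h hx => ⟨h.1.insert hx, hs G x t h.1 hx h.2⟩).2

theorem IsFinSum.eq_zero {s : M} (h : IsFinSum f ISet.empty s) : s = 0 := by
  refine IsFinSum.induction (Φ := fun F s => F = ISet.empty → s = 0) (fun _ => rfl) ?_ h rfl
  intro G x t _ _ _ h
  have : x ∈ (G.insert x).set := Set.mem_insert _ _
  rw [h] at this
  exact this.elim

/-- Any element of the set can be taken as the last one added, by commutativity. This inversion is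
what makes the sum unique. -/
theorem IsFinSum.exists_of_mem {F : ISet α} {s : M} (h : IsFinSum f F s) {x : α} {G : ISet α}
    (hx : x ∉ G.set) (hF : F = G.insert x) : ∃ t, IsFinSum f G t ∧ s = t + f x := by
  obtain ⟨g, rfl⟩ : ∃ g : IFun α M, g.1 = f := ⟨IFun.mk f, rfl⟩
  refine IsFinSum.induction (Φ := fun F s => ∀ x (G : ISet α), x ∉ G.set → F = G.insert x →
    ∃ t, IsFinSum g.1 G t ∧ s = t + g.1 x) ?_ ?_ h x G hx hF
  · intro x G _ h
    have : x ∈ (G.insert x).set := Set.mem_insert _ _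
    rw [← h] at this
    exact this.elim
  · intro G x t hGt hx ih y H hy h
    have key (z : α) : z = x ∨ z ∈ G.set ↔ z = y ∨ z ∈ H.set := by
      have := congrArg (fun S : ISet α => z ∈ S.set) h
      exact iff_of_eq this
    by_cases hxy : x = y
    · subst hxy
      have : G = H := ISet.ext fun z => by
        have := key z
        by_cases hz : z = x
        · subst hz; tauto
        · tauto
      subst this
      exact ⟨t, hGt, rfl⟩
    · have hyG : y ∈ G.set := ((key y).2 (.inl rfl)).resolve_left (Ne.symm hxy)
      have hxH : x ∈ H.set := ((key x).1 (.inl rfl)).resolve_left hxy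
      -- The last element added was `x ≠ y`: take `y` out of `G` first, then put `x` back.
      obtain ⟨t', ht', rfl⟩ := ih y (ISet.mk fun z => z ∈ G.set ∧ z ≠ y) (fun h => h.2 rfl)
        (ISet.ext fun z => by by_cases hz : z = y <;> simp [hz, hyG])
      refine ⟨t' + g.1 x, ?_, by rw [add_right_comm]⟩
      have h1 := ht'.insert (x := x) fun h => hx h.1
      convert! h1 using 1
      refine ISet.ext fun z => ?_
      have := key z
      simp only [ISet.set_insert, Set.mem_insert_iff, ISet.mem_mk]
      by_cases hz : z = y
      · subst hz; tauto
      · by_cases hz : z = x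
        · subst hz; tauto
        · tauto

theorem exists_isFinSum {F : ISet α} (hF : IsFin F.set) : ∃ s, IsFinSum f F s := by
  obtain ⟨g, rfl⟩ : ∃ g : IFun α M, g.1 = f := ⟨IFun.mk f, rfl⟩
  exact ISet.induction (Φ := fun F => ∃ s, IsFinSum g.1 F s) ⟨0, isFinSum_empty _⟩
    (fun G x _ hx ⟨s, h⟩ => ⟨_, h.insert hx⟩) hF

theorem IsFinSum.isFin {F : ISet α} {s : M} (h : IsFinSum f F s) : IsFin F.set :=
  IsFinSum.induction (f := f) (Φ := fun F _ => IsFin F.set) IsFin.empty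
    (fun _ _ _ _ _ h => h.insert _) h

theorem IsFinSum.unique {F : ISet α} {s t : M} (hs : IsFinSum f F s) (ht : IsFinSum f F t) :
    s = t := by
  obtain ⟨g, rfl⟩ : ∃ g : IFun α M, g.1 = f := ⟨IFun.mk f, rfl⟩
  refine ISet.induction (Φ := fun F => ∀ s t, IsFinSum g.1 F s → IsFinSum g.1 F t → s = t)
    ?_ ?_ hs.isFin s t hs ht
  · intro s t hs ht
    rw [hs.eq_zero, ht.eq_zero]
  · intro G x _ hx ih s t hs ht
    obtain ⟨s', hs', rfl⟩ := hs.exists_of_mem hx rfl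
    obtain ⟨t', ht', rfl⟩ := ht.exists_of_mem hx rfl
    rw [ih _ _ hs' ht']

end Uniqueness

open Classical in
/-- The sum of `f` over the finite set `F`, and `0` if `F` is not finite. -/
noncomputable def fsum (f : α → M) (F : ISet α) : M :=
  if h : ∃ s, IsFinSum f F s then h.choose else 0

theorem isFinSum_fsum (f : α → M) [Internal f] {F : ISet α} (hF : IsFin F.set) :
    IsFinSum f F (fsum f F) := by
  have h : ∃ s, IsFinSum f F s := exists_isFinSum hF
  rw [fsum, dif_pos h]
  exact h.choose_spec

theorem IsFinSum.fsum_eq {f : α → M} [Internal f] {F : ISet α} {s : M} (h : IsFinSum f F s) :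
    fsum f F = s := (isFinSum_fsum f h.isFin).unique h

@[simp] theorem fsum_empty (f : α → M) [Internal f] : fsum f ISet.empty = 0 :=
  (isFinSum_empty f).fsum_eq

theorem fsum_insert (f : α → M) [Internal f] {F : ISet α} (hF : IsFin F.set) {x : α}
    (hx : x ∉ F.set) : fsum f (F.insert x) = fsum f F + f x :=
  ((isFinSum_fsum f hF).insert hx).fsum_eq

instance Internal.fsum {f : γ → α → M} {F : γ → ISet α}
    [hf : Internal fun p : γ × α => f p.1 p.2] [hF : Internal F] :
    Internal fun c => fsum (f c) (F c) := by
  obtain ⟨g, hg, hgf⟩ := hf.exists_curry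
  obtain rfl : f = fun c => (g c).1 := funext fun c => funext fun a => (hgf c a).symm
  have : Internal fun q : IFun α M × ISet α => ZFModel.fsum q.1.1 q.2 :=
    -- The second alternative describes the default value `0` on sets that are not finite.
    Internal.of_pred (fun q s => IsFinSum q.1.1 q.2 s ∨ (¬ ∃ t, IsFinSum q.1.1 q.2 t) ∧ s = 0)
      fun q s => by
        by_cases h : IsFin q.2.set
        · have := exists_isFinSum (f := q.1.1) h
          simp only [this, not_true_eq_false, false_and, or_false]
          exact ⟨fun h => h.fsum_eq.symm, fun h' => h' ▸ isFinSum_fsum _ h⟩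
        · have : ¬ ∃ t, IsFinSum q.1.1 q.2 t := fun ⟨t, ht⟩ => h ht.isFin
          rw [ZFModel.fsum, dif_neg this]
          simp only [this, not_false_eq_true, true_and, or_iff_right_iff_imp]
          exact fun h => (this ⟨_, h⟩).elim
  exact this.comp (f := fun c => (g c, F c)) inferInstance

instance Internal.fsum_left {f : α → M} [Internal f] : Internal (ZFModel.fsum f) :=
  have : Internal fun p : ISet α × α => f p.2 := ‹Internal f›.comp Internal.prod_snd
  Internal.fsum (f := fun _ => f) (F := fun F => F)

end Finite

/-! ### Real and complex arithmetic of the model -/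

section Arithmetic

variable {V : Type*} [Membership V V] [ZF V]
variable {α β γ M : Type*} [Coded V α] [Coded V β] [Coded V γ] [Coded V M]
variable [Small α] [Small β] [Small γ] [Small M]

/-- The multiplication of `M` belongs to the model. -/
class InternalMul (M : Type*) {V : Type*} [Coded V M] [Membership V V] [ZF V] [Mul M] : Prop where
  out : Internal fun p : M × M => p.1 * p.2

theorem Internal.mul [Mul M] [h : InternalMul M] {f g : α → M} [Internal f] [Internal g] :
    Internal fun a => f a * g a :=
  h.out.comp (f := fun a => (f a, g a)) inferInstance

variable {R : V} [Field (El R)] [LinearOrder (El R)] [IsStrictOrderedRing (El R)]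
variable [hR : Fact (IsRealField R)]

instance InternalAdd.real : InternalAdd (El R) := ⟨⟨hR.out.add_isSet⟩⟩

instance InternalMul.real : InternalMul (El R) := ⟨⟨hR.out.mul_isSet⟩⟩

section

variable {f g : α → El R} [hf : Internal f] [hg : Internal g]

instance Pred.le : Pred fun a => f a ≤ g a :=
  have : Pred fun p : El R × El R => p.1 ≤ p.2 := ⟨hR.out.le_isSet⟩
  this.comp (f := fun a => (f a, g a)) inferInstance

instance Pred.lt : Pred fun a => f a < g a :=
  (inferInstance : Pred fun a => ¬ g a ≤ f a).congr fun _ => not_le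

instance Pred.lt_left (b : El R) : Pred (LT.lt b) := Pred.lt (f := fun _ => b) (g := fun a => a)

instance Internal.real_add : Internal fun a => f a + g a := Internal.add

instance Internal.real_mul : Internal fun a => f a * g a := Internal.mul

instance Internal.real_sq : Internal fun a => f a ^ 2 := by
  simp_rw [sq]
  infer_instance

instance Internal.neg : Internal fun a => - f a :=
  have : Internal fun a : El R => - a :=
    Internal.of_pred (fun a b => a + b = 0) fun _ _ => (neg_eq_iff_add_eq_zero.symm).trans eq_comm
  this.comp hf

end

instance Small.cplx : Small (Cplx R) := by
  refine Small.of_code (fun z : Cplx R => (z.re, z.im)) (fun _ => rfl)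
    ((inferInstance : Pred fun _ => True).congr fun p => ?_)
  exact ⟨fun _ => ⟨⟨p.1, p.2⟩, rfl⟩, fun _ => trivial⟩

section

variable {f g : α → Cplx R} [hf : Internal f] [hg : Internal g]

theorem Internal.cplx_pair : Internal fun z : Cplx R => (z.re, z.im) :=
  Internal.of_code _ fun _ => rfl

instance Internal.re : Internal fun a => (f a).re :=
  (Internal.prod_fst.comp Internal.cplx_pair).comp hf

instance Internal.im : Internal fun a => (f a).im :=
  (Internal.prod_snd.comp Internal.cplx_pair).comp hf

theorem Internal.cplx_ext {f : α → Cplx R} (h1 : Internal fun a => (f a).re)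
    (h2 : Internal fun a => (f a).im) : Internal f :=
  Internal.of_code_comp (fun z : Cplx R => (z.re, z.im)) (fun _ => rfl) inferInstance

theorem Internal.cplx_mk {f g : α → El R} [Internal f] [Internal g] :
    Internal fun a => (⟨f a, g a⟩ : Cplx R) :=
  Internal.cplx_ext (f := fun a => (⟨f a, g a⟩ : Cplx R)) ‹_› ‹_›

instance InternalAdd.cplx : InternalAdd (Cplx R) := ⟨by
  refine Internal.cplx_ext ?_ ?_ <;> simp only [QuadraticAlgebra.re_add, QuadraticAlgebra.im_add] <;>
    infer_instance⟩

instance InternalMul.cplx : InternalMul (Cplx R) := ⟨by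
  refine Internal.cplx_ext ?_ ?_ <;> simp only [QuadraticAlgebra.re_mul, QuadraticAlgebra.im_mul] <;>
    infer_instance⟩

instance Internal.cplx_add : Internal fun a => f a + g a := Internal.add

instance Internal.cplx_mul : Internal fun a => f a * g a := Internal.mul

instance Internal.cplx_neg : Internal fun a => - f a := by
  refine Internal.cplx_ext ?_ ?_ <;> simp only [QuadraticAlgebra.re_neg, QuadraticAlgebra.im_neg] <;>
    infer_instance

instance Internal.cplx_sub : Internal fun a => f a - g a := by
  simp_rw [sub_eq_add_neg]
  infer_instance

omit [ZF V] [LinearOrder (El R)] [IsStrictOrderedRing (El R)] hR in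
theorem re_star (z : Cplx R) : (star z).re = z.re := by
  obtain ⟨x, y⟩ := z
  simp

theorem im_star (z : Cplx R) : (star z).im = -z.im := rfl

instance Internal.cplx_star : Internal fun a => star (f a) := by
  refine Internal.cplx_ext ?_ ?_ <;> simp only [re_star, im_star] <;> infer_instance

instance Internal.absSq : Internal fun a => absSq (f a) := by
  unfold ZFModel.absSq
  infer_instance

end

theorem absSq_nonneg (z : Cplx R) : 0 ≤ absSq z := by unfold absSq; positivity

@[simp] theorem absSq_zero : absSq (0 : Cplx R) = 0 := by simp [absSq]

theorem absSq_one : absSq (1 : Cplx R) = 1 := by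
  simp [absSq, QuadraticAlgebra.re_one, QuadraticAlgebra.im_one]

theorem absSq_eq_zero {z : Cplx R} : absSq z = 0 ↔ z = 0 := by
  refine ⟨fun h => ?_, fun h => by rw [h, absSq_zero]⟩
  have h1 : z.re ^ 2 = 0 := by unfold absSq at h; nlinarith [sq_nonneg z.re, sq_nonneg z.im]
  have h2 : z.im ^ 2 = 0 := by unfold absSq at h; nlinarith [sq_nonneg z.re, sq_nonneg z.im]
  exact QuadraticAlgebra.ext (by simpa using h1) (by simpa using h2)

theorem absSq_pos {z : Cplx R} (h : z ≠ 0) : 0 < absSq z :=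
  lt_of_le_of_ne (absSq_nonneg z) fun h' => h (absSq_eq_zero.1 h'.symm)

theorem absSq_mul (z w : Cplx R) : absSq (z * w) = absSq z * absSq w := by
  simp only [absSq, QuadraticAlgebra.re_mul, QuadraticAlgebra.im_mul]
  ring

theorem absSq_neg (z : Cplx R) : absSq (-z) = absSq z := by
  simp [absSq]

theorem star_add' (z w : Cplx R) : star (z + w) = star z + star w := by
  ext <;> simp only [re_star, im_star, QuadraticAlgebra.re_add, QuadraticAlgebra.im_add]; ring

theorem star_mul' (z w : Cplx R) : star (z * w) = star z * star w := by
  ext <;> simp only [re_star, im_star, QuadraticAlgebra.re_mul, QuadraticAlgebra.im_mul] <;> ring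

theorem star_star' (z : Cplx R) : star (star z) = z := by
  ext <;> simp only [re_star, im_star, neg_neg]

theorem star_zero' : star (0 : Cplx R) = 0 := by
  ext <;> simp only [re_star, im_star, QuadraticAlgebra.re_zero, QuadraticAlgebra.im_zero, neg_zero]

/-- The weighted form of `2|zw| ≤ t|z|² + t⁻¹|w|²`. It yields the triangle inequality for the
`ℓ²`-norm without square roots or Cauchy-Schwarz, by a choice of `t`. -/
theorem absSq_add_le {z w : Cplx R} {t : El R} (ht : 0 < t) :
    absSq (z + w) ≤ (1 + t) * absSq z + (1 + t⁻¹) * absSq w := by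
  have h (x y : El R) : (x + y) ^ 2 ≤ (1 + t) * x ^ 2 + (1 + t⁻¹) * y ^ 2 := by
    have h1 : (1 + t) * x ^ 2 + (1 + t⁻¹) * y ^ 2 - (x + y) ^ 2 = t * (x - t⁻¹ * y) ^ 2 := by
      field_simp
      ring
    have : 0 ≤ t * (x - t⁻¹ * y) ^ 2 := by positivity
    linarith
  have h1 := h z.re w.re
  have h2 := h z.im w.im
  simp only [absSq, QuadraticAlgebra.re_add, QuadraticAlgebra.im_add]
  linarith

/-! ### Sums of real numbers -/

section Sums

variable {f g : α → El R} [hf : Internal f] [hg : Internal g] {F : ISet α}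

theorem fsum_le_fsum (hF : IsFin F.set) (h : ∀ x, f x ≤ g x) : fsum f F ≤ fsum g F := by
  obtain ⟨f', rfl⟩ : ∃ f' : IFun α (El R), f'.1 = f := ⟨IFun.mk f, rfl⟩
  obtain ⟨g', rfl⟩ : ∃ f' : IFun α (El R), f'.1 = g := ⟨IFun.mk g, rfl⟩
  refine ISet.induction (Φ := fun F => fsum f'.1 F ≤ fsum g'.1 F) (by simp) ?_ hF
  intro G x hG hx ih
  rw [fsum_insert _ hG hx, fsum_insert _ hG hx]
  exact add_le_add ih (h x)

theorem fsum_add (hF : IsFin F.set) : fsum (fun x => f x + g x) F = fsum f F + fsum g F := by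
  obtain ⟨f', rfl⟩ : ∃ f' : IFun α (El R), f'.1 = f := ⟨IFun.mk f, rfl⟩
  obtain ⟨g', rfl⟩ : ∃ f' : IFun α (El R), f'.1 = g := ⟨IFun.mk g, rfl⟩
  refine ISet.induction (Φ := fun F => fsum (fun x => f'.1 x + g'.1 x) F =
    fsum f'.1 F + fsum g'.1 F) (by simp) ?_ hF
  intro G x hG hx ih
  rw [fsum_insert _ hG hx, fsum_insert _ hG hx, fsum_insert _ hG hx, ih]
  ring

theorem fsum_mul_left (c : El R) (hF : IsFin F.set) : fsum (fun x => c * f x) F = c * fsum f F := by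
  obtain ⟨f', rfl⟩ : ∃ f' : IFun α (El R), f'.1 = f := ⟨IFun.mk f, rfl⟩
  refine ISet.induction (Φ := fun F => fsum (fun x => c * f'.1 x) F = c * fsum f'.1 F)
    (by simp) ?_ hF
  intro G x hG hx ih
  rw [fsum_insert _ hG hx, fsum_insert _ hG hx, ih]
  ring

end Sums

end Arithmetic

section Hilbert

variable {V : Type*} [Membership V V] [ZF V]
variable {X R : V} [Field (El R)] [LinearOrder (El R)] [IsStrictOrderedRing (El R)]
variable [hR : Fact (IsRealField R)]
variable {α β : Type*} [Coded V α] [Small α] [Coded V β] [Small β]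

/-! ### The norm -/

instance Pred.sqSumLE {f : α → El X → Cplx R} {b : α → El R}
    [hf : Internal fun p : α × El X => f p.1 p.2] [Internal b] :
    Pred fun a => SqSumLE (f a) (b a) := by
  obtain ⟨g, hg, hgf⟩ := hf.exists_curry
  obtain rfl : f = fun c => (g c).1 := funext fun c => funext fun a => (hgf c a).symm
  have : Pred fun q : IFun (El X) (Cplx R) × El R => SqSumLE q.1.1 q.2 :=
    (inferInstance : Pred fun q : IFun (El X) (Cplx R) × El R =>
      ∀ (F : ISet (El X)) (s : El R), IsFinSum (fun x => absSq (q.1.1 x)) F s → s ≤ q.2)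
  exact this.comp (f := fun a => (g a, b a)) inferInstance

instance Pred.normLE {f : α → El X → Cplx R} {c : α → El R}
    [Internal fun p : α × El X => f p.1 p.2] [Internal c] :
    Pred fun a => NormLE (f a) (c a) :=
  (inferInstance : Pred fun a => 0 ≤ c a ∧ SqSumLE (f a) (c a ^ 2))

section

variable {f g : El X → Cplx R} [hf : Internal f] [hg : Internal g]

theorem sqSumLE_iff {b : El R} : SqSumLE f b ↔
    ∀ F : ISet (El X), IsFin F.set → fsum (fun x => absSq (f x)) F ≤ b := by
  refine forall_congr' fun F => ⟨fun h hF => h _ (isFinSum_fsum _ hF), fun h s hs => ?_⟩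
  rw [← hs.fsum_eq]
  exact h hs.isFin

theorem SqSumLE.mono {b c : El R} (h : SqSumLE f b) (hbc : b ≤ c) : SqSumLE f c :=
  fun F s hs => (h F s hs).trans hbc

theorem SqSumLE.nonneg {b : El R} (h : SqSumLE f b) : 0 ≤ b := by
  have := sqSumLE_iff.1 h ISet.empty IsFin.empty
  simpa using this

theorem SqSumLE.apply_le {b : El R} (h : SqSumLE f b) (x : El X) : absSq (f x) ≤ b := by
  have := sqSumLE_iff.1 h (ISet.empty.insert x) (IsFin.empty.insert x)
  rw [fsum_insert _ IsFin.empty (Set.notMem_empty x)] at this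
  simpa using this

theorem SqSumLE.add_of_pos {b c t : El R} (hf : SqSumLE f b) (hg : SqSumLE g c) (ht : 0 < t) :
    SqSumLE (fun x => f x + g x) ((1 + t) * b + (1 + t⁻¹) * c) := by
  refine sqSumLE_iff.2 fun F hF => ?_
  refine (fsum_le_fsum hF fun x => absSq_add_le (t := t) ht).trans ?_
  rw [fsum_add hF, fsum_mul_left _ hF, fsum_mul_left _ hF]
  have h1 := sqSumLE_iff.1 hf F hF
  have h2 := sqSumLE_iff.1 hg F hF
  gcongr

theorem SqSumLE.mul {b : El R} (hf : SqSumLE f b) (z : Cplx R) :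
    SqSumLE (fun x => z * f x) (absSq z * b) := by
  refine sqSumLE_iff.2 fun F hF => ?_
  simp_rw [absSq_mul]
  rw [fsum_mul_left _ hF]
  exact mul_le_mul_of_nonneg_left (sqSumLE_iff.1 hf F hF) (absSq_nonneg z)

theorem SqSumLE.eq_zero (h : SqSumLE f 0) (x : El X) : f x = 0 :=
  absSq_eq_zero.1 (le_antisymm (h.apply_le x) (absSq_nonneg _))

theorem sqSumLE_zero {b : El R} (hb : 0 ≤ b) (h : ∀ x, f x = 0) : SqSumLE f b := by
  refine sqSumLE_iff.2 fun F hF => ?_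
  -- Zero is written as `0 * 0` so that `fsum_mul_left` shows the sum to vanish.
  have : fsum (fun x => absSq (f x)) F ≤ fsum (fun _ => (0 : El R) * 0) F :=
    fsum_le_fsum hF fun x => by simp [h x]
  rw [fsum_mul_left _ hF] at this
  linarith

theorem NormLE.mono {a b : El R} (h : NormLE f a) (hab : a ≤ b) : NormLE f b :=
  ⟨h.1.trans hab, h.2.mono (by have := h.1; gcongr)⟩

theorem normLE_zero {a : El R} (ha : 0 ≤ a) (h : ∀ x, f x = 0) : NormLE f a :=
  ⟨ha, sqSumLE_zero (sq_nonneg a) h⟩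

theorem NormLE.add {a b : El R} (hf : NormLE f a) (hg : NormLE g b) :
    NormLE (fun x => f x + g x) (a + b) := by
  refine ⟨add_nonneg hf.1 hg.1, ?_⟩
  rcases hf.1.eq_or_lt with rfl | ha
  · have h0 : ∀ x, f x = 0 := SqSumLE.eq_zero (by simpa using hf.2)
    simp only [h0, zero_add]
    exact hg.2
  rcases hg.1.eq_or_lt with rfl | hb
  · have h0 : ∀ x, g x = 0 := SqSumLE.eq_zero (by simpa using hg.2)
    simp only [h0, add_zero]
    exact hf.2
  -- With `t = b / a` the bound `(1 + t) a² + (1 + t⁻¹) b²` is exactly `(a + b)²`.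
  · refine (hf.2.add_of_pos hg.2 (div_pos hb ha)).mono (le_of_eq ?_)
    field_simp
    ring

theorem NormLE.mul {a r : El R} (hf : NormLE f a) {z : Cplx R} (hr : 0 ≤ r)
    (hz : absSq z ≤ r ^ 2) : NormLE (fun x => z * f x) (r * a) := by
  refine ⟨mul_nonneg hr hf.1, (hf.2.mul z).mono ?_⟩
  rw [mul_pow]
  gcongr

theorem NormLE.apply_le {a : El R} (h : NormLE f a) (x : El X) : absSq (f x) ≤ a ^ 2 :=
  h.2.apply_le x

theorem SqSumLE.exists_normLE {b : El R} (h : SqSumLE f b) : ∃ c, NormLE f c := by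
  have hb := h.nonneg
  -- A square root of `b` is not needed, since `b ≤ (1 + b)²`.
  exact ⟨1 + b, by positivity, h.mono (by nlinarith)⟩

end

theorem exists_absSq_le (z : Cplx R) : ∃ r : El R, 0 < r ∧ absSq z ≤ r ^ 2 := by
  have := absSq_nonneg z
  exact ⟨1 + absSq z, by positivity, by nlinarith⟩

/-! ### Vectors -/

instance Small.l2 : Small (L2 X R) := by
  refine Small.of_code (fun η : L2 X R => η.toIFun) (fun _ => rfl)
    ((inferInstance : Pred fun f : IFun (El X) (Cplx R) => ∃ b, SqSumLE f.1 b).congr fun f => ?_)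
  exact ⟨fun h => ⟨⟨f, h⟩, rfl⟩, by rintro ⟨η, rfl⟩; exact η.summable⟩

instance Internal.l2_toIFun {η : α → L2 X R} [h : Internal η] : Internal fun a => (η a).toIFun :=
  (Internal.of_code (fun η : L2 X R => η.toIFun) fun _ => rfl).comp h

instance Internal.l2_toIFun' : Internal (L2.toIFun : L2 X R → _) :=
  Internal.l2_toIFun (η := fun η => η)

theorem Internal.l2 {η : α → L2 X R} (h : Internal fun p : α × El X => (η p.1).toIFun.1 p.2) :
    Internal η :=
  Internal.of_code_comp (fun η : L2 X R => η.toIFun) (fun _ => rfl) (Internal.iFun h)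

theorem L2.ext {η ζ : L2 X R} (h : ∀ x, η x = ζ x) : η = ζ := by
  cases η; cases ζ
  congr
  exact IFun.ext h

theorem L2.exists_normLE (η : L2 X R) : ∃ c, NormLE η c := η.summable.elim fun _ h => h.exists_normLE

/-- The vector `c η + ζ`. -/
noncomputable def L2.lin (c : Cplx R) (η ζ : L2 X R) : L2 X R where
  toIFun := IFun.mk fun x => c * η x + ζ x
  summable := by
    obtain ⟨a, ha⟩ := η.exists_normLE
    obtain ⟨b, hb⟩ := ζ.exists_normLE
    obtain ⟨r, hr, h⟩ := exists_absSq_le c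
    exact ⟨_, ((ha.mul hr.le h).add hb).2⟩

@[simp] theorem L2.lin_apply (c : Cplx R) (η ζ : L2 X R) (x : El X) :
    L2.lin c η ζ x = c * η x + ζ x := rfl

instance Internal.l2_lin {c : α → Cplx R} {η ζ : α → L2 X R} [Internal c] [Internal η]
    [Internal ζ] : Internal fun a => L2.lin (c a) (η a) (ζ a) :=
  Internal.l2 (by
    have : Internal fun p : α × El X => c p.1 := ‹Internal c›.comp Internal.prod_fst
    have : Internal fun p : α × El X => η p.1 := ‹Internal η›.comp Internal.prod_fst
    have : Internal fun p : α × El X => ζ p.1 := ‹Internal ζ›.comp Internal.prod_fst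
    simp only [L2.lin_apply]
    infer_instance)

open Classical in
theorem sqSumLE_single (x : El X) (z : Cplx R) :
    SqSumLE (fun y => if y = x then z else 0) (absSq z) := by
  refine sqSumLE_iff.2 fun F hF => ?_
  -- The induction needs the sharper bound that stays `0` until `x` has entered the set.
  have key : fsum (fun y => absSq (if y = x then z else 0)) F ≤
      if x ∈ F.set then absSq z else 0 := by
    refine ISet.induction (Φ := fun F => fsum (fun y => absSq (if y = x then z else 0)) F ≤
      if x ∈ F.set then absSq z else 0) (by simp) ?_ hF
    intro G y hG hy ih
    rw [fsum_insert _ hG hy]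
    by_cases hyx : y = x
    · subst hyx
      rw [if_neg hy] at ih
      simpa using ih
    · have : x ∈ (G.insert y).set ↔ x ∈ G.set :=
        ⟨fun h => h.resolve_left (Ne.symm hyx), fun h => .inr h⟩
      simp only [this, if_neg hyx, absSq_zero, add_zero]
      exact ih
  refine key.trans ?_
  split_ifs
  · exact le_rfl
  · exact absSq_nonneg z

open Classical in
/-- The vector `z e_x`. -/
noncomputable def L2.single (x : El X) (z : Cplx R) : L2 X R where
  toIFun := IFun.mk fun y => if y = x then z else 0
  summable := ⟨_, sqSumLE_single x z⟩

open Classical in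
theorem L2.single_apply (x : El X) (z : Cplx R) (y : El X) :
    L2.single x z y = if y = x then z else 0 := rfl

@[simp] theorem L2.single_self (x : El X) (z : Cplx R) : L2.single x z x = z := by
  rw [L2.single_apply, if_pos rfl]

theorem L2.single_of_ne {x y : El X} (h : y ≠ x) (z : Cplx R) : L2.single x z y = 0 := by
  rw [L2.single_apply, if_neg h]

instance Internal.l2_single {x : α → El X} {z : α → Cplx R} [Internal x] [Internal z] :
    Internal fun a => L2.single (x a) (z a) :=
  Internal.l2 (by
    have : Internal fun p : α × El X => x p.1 := ‹Internal x›.comp Internal.prod_fst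
    have : Internal fun p : α × El X => z p.1 := ‹Internal z›.comp Internal.prod_fst
    simp only [L2.single_apply]
    infer_instance)

theorem normLE_single {x : El X} {z : Cplx R} {r : El R} (hr : 0 ≤ r) (h : absSq z ≤ r ^ 2) :
    NormLE (L2.single x z) r := ⟨hr, (sqSumLE_single x z).mono h⟩

/-- The zero vector. -/
noncomputable def L2.zero : L2 X R where
  toIFun := IFun.mk fun _ => 0
  summable := ⟨0, sqSumLE_zero le_rfl fun _ => rfl⟩

@[simp] theorem L2.zero_apply (x : El X) : (L2.zero : L2 X R) x = 0 := rfl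

/-! ### Operators -/

instance Small.op : Small (Op X R) := by
  refine Small.of_code (fun T : Op X R => T.toIFun) (fun _ => rfl)
    ((inferInstance : Pred fun f : IFun (L2 X R) (L2 X R) =>
      ∀ (c : Cplx R) (η ζ θ : L2 X R), (∀ x, θ.toIFun.1 x = c * η.toIFun.1 x + ζ.toIFun.1 x) →
    ∀ x, (f.1 θ).toIFun.1 x = c * (f.1 η).toIFun.1 x + (f.1 ζ).toIFun.1 x).congr fun f => ?_)
  exact ⟨fun h => ⟨⟨f, h⟩, rfl⟩, by rintro ⟨T, rfl⟩; exact T.linear⟩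

instance Internal.op_toIFun {T : α → Op X R} [h : Internal T] : Internal fun a => (T a).toIFun :=
  (Internal.of_code (fun T : Op X R => T.toIFun) fun _ => rfl).comp h

theorem Internal.op {T : α → Op X R} (h : Internal fun p : α × L2 X R => (T p.1).toIFun.1 p.2) :
    Internal T :=
  Internal.of_code_comp (fun T : Op X R => T.toIFun) (fun _ => rfl) (Internal.iFun h)

theorem Op.ext {S T : Op X R} (h : ∀ η x, S η x = T η x) : S = T := by
  cases S; cases T
  congr
  exact IFun.ext fun η => L2.ext (h η)

theorem Op.map_lin (T : Op X R) (c : Cplx R) (η ζ : L2 X R) (x : El X) :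
    T (L2.lin c η ζ) x = c * T η x + T ζ x := T.linear c η ζ _ (fun _ => rfl) x

theorem Op.map_zero (T : Op X R) {η : L2 X R} (h : ∀ x, η x = 0) (x : El X) : T η x = 0 := by
  -- A zero vector satisfies `η = 1 · η + η`.
  have := T.linear 1 η η η (fun y => by simp [h]) x
  linear_combination -this

/-- The operator `c S + T`. -/
noncomputable def Op.lin (c : Cplx R) (S T : Op X R) : Op X R where
  toIFun := IFun.mk fun η => L2.lin c (S η) (T η)
  linear a η ζ θ h x := by
    show c * S θ x + T θ x = a * (c * S η x + T η x) + (c * S ζ x + T ζ x)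
    rw [S.linear a η ζ θ h x, T.linear a η ζ θ h x]
    ring

@[simp] theorem Op.lin_apply (c : Cplx R) (S T : Op X R) (η : L2 X R) (x : El X) :
    Op.lin c S T η x = c * S η x + T η x := rfl

/-- The identity operator. -/
noncomputable def Op.id : Op X R where
  toIFun := IFun.mk fun η => η
  linear _ _ _ _ h x := h x

@[simp] theorem Op.id_apply (η : L2 X R) : (Op.id : Op X R) η = η := rfl

/-- The zero operator. -/
noncomputable def Op.zero : Op X R where
  toIFun := IFun.mk fun _ => L2.zero
  linear _ _ _ _ _ x := by simp [IFun.mk]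

@[simp] theorem Op.zero_apply (η : L2 X R) : (Op.zero : Op X R) η = L2.zero := rfl

/-- The composition of operators. -/
noncomputable def Op.comp (S T : Op X R) : Op X R where
  toIFun := IFun.mk fun η => S.toIFun.1 (T.toIFun.1 η)
  linear c η ζ θ h x := S.linear c _ _ _ (T.linear c η ζ θ h) x

/-- The matrix unit that maps `e_y` to `e_x`. -/
noncomputable def Op.unit (x y : El X) : Op X R where
  toIFun := IFun.mk fun η => L2.single x (η.toIFun.1 y)
  linear c η ζ θ h w := by
    show L2.single x (θ y) w = c * L2.single x (η y) w + L2.single x (ζ y) w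
    by_cases hw : w = x <;> simp [L2.single_apply, hw, h y]

instance Internal.op_unit {x y : α → El X} [Internal x] [Internal y] :
    Internal fun a => (Op.unit (x a) (y a) : Op X R) :=
  Internal.op (by
    have : Internal fun p : α × L2 X R => x p.1 := ‹Internal x›.comp Internal.prod_fst
    have : Internal fun p : α × L2 X R => y p.1 := ‹Internal y›.comp Internal.prod_fst
    have : Internal fun p : α × L2 X R => L2.single (x p.1) (p.2.toIFun.1 (y p.1)) := inferInstance
    exact this)

/-! ### Bounded operators -/

instance Pred.boundedOps : Pred fun T : Op X R => T ∈ boundedOps X R :=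
  (inferInstance : Pred fun T : Op X R => ∃ M : El R, 0 ≤ M ∧ ∀ (η : L2 X R) (c : El R),
    NormLE η.toIFun.1 c → NormLE (T.toIFun.1 η).toIFun.1 (M * c))

theorem lin_mem_boundedOps {S T : Op X R} (hS : S ∈ boundedOps X R) (hT : T ∈ boundedOps X R)
    (c : Cplx R) : Op.lin c S T ∈ boundedOps X R := by
  obtain ⟨M, hM, hM'⟩ := hS
  obtain ⟨N, hN, hN'⟩ := hT
  obtain ⟨r, hr, h⟩ := exists_absSq_le c
  refine ⟨r * M + N, by positivity, fun η a ha => ?_⟩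
  have := ((hM' η a ha).mul hr.le h).add (hN' η a ha)
  rw [← mul_assoc, ← add_mul] at this
  exact this

theorem comp_mem_boundedOps {S T : Op X R} (hS : S ∈ boundedOps X R) (hT : T ∈ boundedOps X R) :
    S.comp T ∈ boundedOps X R := by
  obtain ⟨M, hM, hM'⟩ := hS
  obtain ⟨N, hN, hN'⟩ := hT
  refine ⟨M * N, by positivity, fun η a ha => ?_⟩
  rw [mul_assoc]
  exact hM' _ _ (hN' η a ha)

theorem id_mem_boundedOps : (Op.id : Op X R) ∈ boundedOps X R :=
  ⟨1, zero_le_one, fun η c h => by rw [one_mul]; exact h⟩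

theorem zero_mem_boundedOps : (Op.zero : Op X R) ∈ boundedOps X R :=
  ⟨0, le_rfl, fun η c h => normLE_zero (by simp) fun _ => rfl⟩

theorem unit_mem_boundedOps (x y : El X) : (Op.unit x y : Op X R) ∈ boundedOps X R :=
  ⟨1, zero_le_one, fun η c h => by
    rw [one_mul]
    exact normLE_single h.1 (h.apply_le y)⟩

end Hilbert

/-! ### Amorphous sets -/

section Amorphous

variable {V : Type*} [Membership V V] [ZF V]

/-- The integers modulo `2`, as a set of the model. -/
def Two (V : Type*) [Membership V V] [ZF V] : Type := id (α := Type) (ZMod 2)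

/-- The empty set and its singleton; they serve as codes of the residues `0` and `1`. -/
theorem exists_ne_elements (V : Type*) [Membership V V] [ZF V] : ∃ p : V × V, p.1 ≠ p.2 := by
  obtain ⟨w, ⟨e, -, he⟩, -⟩ := ZF.infinity (V := V)
  exact ⟨(e, upair e e), fun h => he e ((congrArg (e ∈ ·) h).mpr (mem_upair.2 (.inl rfl)))⟩

namespace Two

instance : AddCommGroup (Two V) := inferInstanceAs (AddCommGroup (ZMod 2))

instance : One (Two V) := inferInstanceAs (One (ZMod 2))

theorem eq_zero_or_one (a : Two V) : a = 0 ∨ a = 1 :=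
  (by decide : ∀ a : ZMod 2, a = 0 ∨ a = 1) a

theorem one_ne_zero : (1 : Two V) ≠ 0 := (by decide : (1 : ZMod 2) ≠ 0)

theorem one_add_one : (1 : Two V) + 1 = 0 := (by decide : (1 : ZMod 2) + 1 = 0)

open Classical in
noncomputable instance : Coded V (Two V) where
  code a := if a = 0 then (exists_ne_elements V).choose.1 else (exists_ne_elements V).choose.2
  code_injective a b h := by
    have hne := (exists_ne_elements V).choose_spec
    rcases eq_zero_or_one a with rfl | rfl <;> rcases eq_zero_or_one b with rfl | rfl
    · rfl
    · simp only [if_true, if_neg one_ne_zero] at h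
      exact (hne h).elim
    · simp only [if_true, if_neg one_ne_zero] at h
      exact (hne h.symm).elim
    · rfl

instance : Small (Two V) := by
  refine ⟨upair (exists_ne_elements V).choose.1 (exists_ne_elements V).choose.2, fun z =>
    mem_upair.trans ⟨?_, ?_⟩⟩
  · rintro (rfl | rfl)
    · exact ⟨0, if_pos rfl⟩
    · exact ⟨1, if_neg one_ne_zero⟩
  · rintro ⟨a, rfl⟩
    rcases eq_zero_or_one a with rfl | rfl
    · exact .inl (if_pos rfl)
    · exact .inr (if_neg one_ne_zero)

instance : InternalAdd (Two V) := ⟨Internal.of_pred (fun p b =>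
    (p.1 = 0 ∧ b = p.2) ∨ (p.1 = 1 ∧ p.2 = 0 ∧ b = 1) ∨ (p.1 = 1 ∧ p.2 = 1 ∧ b = 0)) fun p b => by
  obtain ⟨x, y⟩ := p
  rcases eq_zero_or_one x with rfl | rfl
  · simp [one_ne_zero.symm]
  · rcases eq_zero_or_one y with rfl | rfl <;>
      simp [one_ne_zero, one_ne_zero.symm, one_add_one]⟩

end Two

variable {X : V}

theorem exists_least (𝓢 : ISet (ISet (El X))) (hfin : ∀ A ∈ 𝓢.set, IsFin A.set)
    (hchain : ∀ A ∈ 𝓢.set, ∀ B ∈ 𝓢.set, A.set ⊆ B.set ∨ B.set ⊆ A.set) (hne : 𝓢.set.Nonempty) :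
    ∃ A ∈ 𝓢.set, ∀ B ∈ 𝓢.set, A.set ⊆ B.set := by
  obtain ⟨A, hA, h⟩ := exists_minimal 𝓢 hfin hne
  refine ⟨A, hA, fun B hB => (hchain A hA B hB).elim id fun hBA => ?_⟩
  rw [h B hB hBA]

/-- A finite subset of the union of a chain is contained in a member of the chain. -/
theorem exists_subset_of_chain {𝓑 : ISet (ISet (El X))} (hne : 𝓑.set.Nonempty)
    (hchain : ∀ A ∈ 𝓑.set, ∀ B ∈ 𝓑.set, A.set ⊆ B.set ∨ B.set ⊆ A.set) {S : Set (El X)}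
    (hS : IsFin S) : S ⊆ {x | ∃ B ∈ 𝓑.set, x ∈ B.set} → ∃ B ∈ 𝓑.set, S ⊆ B.set := by
  refine IsFin.induction (Φ := fun S => S ⊆ {x | ∃ B ∈ 𝓑.set, x ∈ B.set} →
    ∃ B ∈ 𝓑.set, S ⊆ B.set) (fun _ => ?_) ?_ hS
  · obtain ⟨B, hB⟩ := hne
    exact ⟨B, hB, Set.empty_subset _⟩
  · intro G x _ _ ih h
    obtain ⟨B, hB, hGB⟩ := ih fun y hy => h (.inr hy)
    obtain ⟨C, hC, hxC⟩ := h (.inl rfl)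
    rcases hchain B hB C hC with hBC | hCB
    · exact ⟨C, hC, Set.insert_subset hxC (hGB.trans hBC)⟩
    · exact ⟨B, hB, Set.insert_subset (hCB hxC) hGB⟩

/-- The union of a chain of finite subsets of an amorphous set is finite. -/
theorem IsAmorphous.isFin_union_of_chain (hX : IsAmorphous X) (𝓑 : ISet (ISet (El X)))
    (hfin : ∀ B ∈ 𝓑.set, IsFin B.set)
    (hchain : ∀ A ∈ 𝓑.set, ∀ B ∈ 𝓑.set, A.set ⊆ B.set ∨ B.set ⊆ A.set) :
    IsFin {x | ∃ B ∈ 𝓑.set, x ∈ B.set} := by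
  -- If the union is infinite, the chain has no last member and every member has an immediate
  -- successor. Colour each point by the parity of the position of the first member that contains
  -- it. Both colours occur outside every member, so neither class is finite, against amorphousness.
  by_contra hinf
  have hne : 𝓑.set.Nonempty := by
    by_contra h
    rw [Set.not_nonempty_iff_eq_empty] at h
    refine hinf ?_
    convert! (IsFin.empty (α := El X)) using 1
    ext; simp [h]
  have hne' : ∀ B ∈ 𝓑.set, ∃ C ∈ 𝓑.set, ¬ C.set ⊆ B.set := by
    intro B hB
    by_contra! h
    exact hinf ((hfin B hB).subset fun x ⟨C, hC, hx⟩ => h C hC hx)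
  have hnext : ∀ B ∈ 𝓑.set, ∃ C ∈ 𝓑.set, ¬ C.set ⊆ B.set ∧
      ∀ D ∈ 𝓑.set, ¬ D.set ⊆ B.set → C.set ⊆ D.set := by
    intro B hB
    obtain ⟨C, hC, hC'⟩ := exists_least (ISet.mk fun C => C ∈ 𝓑.set ∧ ¬ C.set ⊆ B.set)
      (fun A hA => hfin A hA.1) (fun A hA B hB => hchain A hA.1 B hB.1)
      (let ⟨C, hC, h⟩ := hne' B hB; ⟨C, hC, h⟩)
    exact ⟨C, hC.1, hC.2, fun D hD h => hC' D ⟨hD, h⟩⟩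
  set S : ISet (El X) → ISet (ISet (El X)) := fun B =>
    ISet.mk fun C => C ∈ 𝓑.set ∧ C.set ⊆ B.set with hS
  have hSint : Internal S :=
    have : Pred fun p : ISet (El X) × ISet (El X) => p.2 ∈ (S p.1).set :=
      (inferInstance : Pred fun p : ISet (El X) × ISet (El X) => p.2 ∈ 𝓑.set ∧ p.2.set ⊆ p.1.set)
    Internal.iSet
  have hSfin : ∀ B ∈ 𝓑.set, IsFin (S B).set := fun B hB =>
    (hfin B hB).powerset.subset fun C hC => hC.2
  -- The position of `B` is the number of members contained in `B`, a finite number; only its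
  -- residue modulo 2 is recorded.
  set par : ISet (El X) → Two V := fun B => fsum (fun _ => 1) (S B) with hpar
  have hparint : Internal par := inferInstanceAs (Internal fun B => fsum (fun _ => (1 : Two V)) (S B))
  -- Passing to the successor flips the parity, so one or two steps reach either parity with a point
  -- not yet in `B`.
  have hstep : ∀ B ∈ 𝓑.set, ∀ t : Two V, ∃ C ∈ 𝓑.set, ∃ x ∈ C.set, x ∉ B.set ∧
      (∀ D ∈ 𝓑.set, x ∈ D.set → C.set ⊆ D.set) ∧ par C = t := by
    have key : ∀ B ∈ 𝓑.set, ∃ C ∈ 𝓑.set, ∃ x ∈ C.set, x ∉ B.set ∧ B.set ⊆ C.set ∧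
        (∀ D ∈ 𝓑.set, x ∈ D.set → C.set ⊆ D.set) ∧ par C = par B + 1 := by
      intro B hB
      obtain ⟨C, hC, hCB, hleast⟩ := hnext B hB
      have hBC : B.set ⊆ C.set := (hchain B hB C hC).resolve_right hCB
      obtain ⟨x, hxC, hxB⟩ := Set.not_subset.1 hCB
      refine ⟨C, hC, x, hxC, hxB, hBC, fun D hD hx => hleast D hD fun h => hxB (h hx), ?_⟩
      have hSC : S C = (S B).insert C := by
        refine ISet.ext fun D => ⟨fun ⟨hD, hDC⟩ => ?_, ?_⟩
        · by_cases h : D.set ⊆ B.set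
          · exact .inr ⟨hD, h⟩
          · exact .inl (ISet.set_injective (hDC.antisymm (hleast D hD h)))
        · rintro (rfl | ⟨hD, hDB⟩)
          · exact ⟨hC, subset_rfl⟩
          · exact ⟨hD, hDB.trans hBC⟩
      rw [hpar]
      simp only
      rw [hSC, fsum_insert _ (hSfin B hB) fun h => hCB h.2]
    intro B hB t
    obtain ⟨C, hC, x, hxC, hxB, hBC, hleast, hCpar⟩ := key B hB
    by_cases h : par C = t
    · exact ⟨C, hC, x, hxC, hxB, hleast, h⟩
    · obtain ⟨D, hD, y, hyD, hyC, -, hleast', hDpar⟩ := key C hC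
      refine ⟨D, hD, y, hyD, fun h => hyC (hBC h), hleast', ?_⟩
      rw [hDpar]
      rcases Two.eq_zero_or_one (par C) with h0 | h0 <;> rcases Two.eq_zero_or_one t with rfl | rfl
      · exact (h h0).elim
      · rw [h0, zero_add]
      · rw [h0, Two.one_add_one]
      · exact (h h0).elim
  let par' : IFun (ISet (El X)) (Two V) := IFun.mk par
  let E : ISet (El X) := ISet.mk fun x => ∃ B ∈ 𝓑.set, x ∈ B.set ∧
    (∀ C ∈ 𝓑.set, x ∈ C.set → B.set ⊆ C.set) ∧ par'.1 B = 0
  -- Whichever of the two colour classes is finite lies in a single member of the chain, yet `hstep`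
  -- produces a point of it outside that member.
  rcases hX.2 E.set E.2 with hE | hE
  · obtain ⟨B, hB, hEB⟩ := exists_subset_of_chain hne hchain hE
      fun x ⟨B, hB, hx, _⟩ => ⟨B, hB, hx⟩
    obtain ⟨C, hC, x, hxC, hxB, hleast, h0⟩ := hstep B hB 0
    exact hxB (hEB ⟨C, hC, hxC, hleast, h0⟩)
  · have hE' : IsFin {x | x ∉ E.set ∧ ∃ B ∈ 𝓑.set, x ∈ B.set} := hE.subset fun x hx => hx.1
    obtain ⟨B, hB, hEB⟩ := exists_subset_of_chain hne hchain hE' fun x hx => hx.2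
    obtain ⟨C, hC, x, hxC, hxB, hleast, h1⟩ := hstep B hB 1
    refine hxB (hEB ⟨?_, C, hC, hxC⟩)
    rintro ⟨D, hD, hxD, hleast', h0⟩
    have : C = D := ISet.set_injective ((hleast D hD hxD).antisymm (hleast' C hC hxC))
    rw [this] at h1
    exact Two.one_ne_zero (h1.symm.trans h0)

/-- A real function on an amorphous set is constant up to finitely many points. -/
theorem IsAmorphous.exists_isFin_ne (hX : IsAmorphous X) {R : V} [Field (El R)]
    [LinearOrder (El R)] [IsStrictOrderedRing (El R)] [hR : Fact (IsRealField R)]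
    (f : El X → El R) [hf : Internal f] : ∃ s, IsFin {x | f x ≠ s} := by
  obtain ⟨g, rfl⟩ : ∃ g : IFun (El X) (El R), g.1 = f := ⟨IFun.mk f, rfl⟩
  -- Sublevel sets are nested, and so are superlevel sets below; so a union of finite ones is
  -- finite.
  have hlow (D : ISet (El R)) (hD : ∀ r ∈ D.set, IsFin {x | g.1 x ≤ r}) :
      IsFin {x | ∃ r ∈ D.set, g.1 x ≤ r} := by
    have := hX.isFin_union_of_chain (ISet.mk fun B => ∃ r ∈ D.set, B.set = {x | g.1 x ≤ r})
      (by rintro B ⟨r, hr, h⟩; rw [h]; exact hD r hr)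
      (by
        rintro A ⟨r, -, hA⟩ B ⟨s, -, hB⟩
        rw [hA, hB]
        rcases le_total r s with h | h
        · exact .inl fun x hx => le_trans hx h
        · exact .inr fun x hx => le_trans hx h)
    refine this.subset ?_
    rintro x ⟨r, hr, hx⟩
    exact ⟨ISet.mk fun x => g.1 x ≤ r, ⟨r, hr, rfl⟩, hx⟩
  have hupp (D : ISet (El R)) (hD : ∀ r ∈ D.set, IsFin {x | r < g.1 x}) :
      IsFin {x | ∃ r ∈ D.set, r < g.1 x} := by
    have := hX.isFin_union_of_chain (ISet.mk fun B => ∃ r ∈ D.set, B.set = {x | r < g.1 x})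
      (by rintro B ⟨r, hr, h⟩; rw [h]; exact hD r hr)
      (by
        rintro A ⟨r, -, hA⟩ B ⟨s, -, hB⟩
        rw [hA, hB]
        rcases le_total r s with h | h
        · exact .inr fun x hx => lt_of_le_of_lt h hx
        · exact .inl fun x hx => lt_of_le_of_lt h hx)
    refine this.subset ?_
    rintro x ⟨r, hr, hx⟩
    exact ⟨ISet.mk fun x => r < g.1 x, ⟨r, hr, rfl⟩, hx⟩
  have hcompl (r : El R) (h : ¬ IsFin {x | g.1 x ≤ r}) : IsFin {x | r < g.1 x} := by
    have := (hX.2 _ (ISet.mk fun x => g.1 x ≤ r).2).resolve_left h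
    refine this.subset fun x hx => ?_
    exact not_le.2 hx
  -- The supremum of `L` is the generic value. `L` is nonempty and bounded above, since otherwise
  -- `X` would be the union of a chain of finite superlevel or sublevel sets.
  let L : ISet (El R) := ISet.mk fun r => IsFin {x | g.1 x ≤ r}
  have hL1 : L.set.Nonempty := by
    by_contra h
    refine hX.1 ((hupp (ISet.mk fun _ => True) fun r _ => hcompl r fun h' => h ⟨r, h'⟩).subset ?_)
    exact fun x _ => ⟨g.1 x - 1, trivial, by linarith⟩
  have hL2 : BddAbove L.set := by
    by_contra h
    have : ∀ r, IsFin {x | g.1 x ≤ r} := fun r => by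
      by_contra hr
      refine h ⟨r, fun s hs => ?_⟩
      by_contra! hrs
      exact hr (IsFin.subset hs fun x hx => le_trans hx hrs.le)
    refine hX.1 ((hlow (ISet.mk fun _ => True) fun r _ => this r).subset ?_)
    exact fun x _ => ⟨g.1 x, trivial, le_rfl⟩
  obtain ⟨s, hs⟩ := hR.out.complete L.set L.2 hL1 hL2
  -- Points below `s` lie in a sublevel set with `r ∈ L`; points above `s` lie in a superlevel set
  -- with `r > s`, which is finite because `r ∉ L`.
  refine ⟨s, IsFin.subset ((hlow L fun r hr => hr).union (hupp (ISet.mk fun r => s < r)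
    fun r hr => hcompl r fun h => (hs.1 h).not_gt hr)) fun x hx => ?_⟩
  rcases lt_or_gt_of_ne hx with h | h
  · obtain ⟨r, hr, hxr, -⟩ := hs.exists_between h
    exact .inl ⟨r, hr, hxr.le⟩
  · obtain ⟨r, h1, h2⟩ := exists_between h
    exact .inr ⟨r, h1, h2⟩

end Amorphous

/-! ### Locally finite graphs on amorphous sets -/

section Rigid

variable {V : Type*} [Membership V V] [ZF V] {X : V}

/-- The connected component of a point in a locally finite graph on an amorphous set is finite. -/
theorem IsAmorphous.exists_isFin_closed (hX : IsAmorphous X) (G : ISet (El X × El X))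
    (hfin : ∀ x, IsFin {y | (x, y) ∈ G.set}) (x : El X) :
    ∃ C : ISet (El X), IsFin C.set ∧ x ∈ C.set ∧ ∀ y z, (y, z) ∈ G.set → y ∈ C.set → z ∈ C.set := by
  let N : ISet (El X) → ISet (El X) := fun B =>
    ISet.mk fun z => z ∈ B.set ∨ ∃ y ∈ B.set, (y, z) ∈ G.set
  have hNint : Internal N :=
    have : Pred fun p : ISet (El X) × El X => p.2 ∈ (N p.1).set :=
      (inferInstance : Pred fun p : ISet (El X) × El X =>
        p.2 ∈ p.1.set ∨ ∃ y ∈ p.1.set, (y, p.2) ∈ G.set)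
    Internal.iSet
  let N' : IFun (ISet (El X)) (ISet (El X)) := IFun.mk N
  have hN' : ∀ B, N'.1 B = N B := fun _ => rfl
  have hmono {A B : ISet (El X)} (h : A.set ⊆ B.set) : (N A).set ⊆ (N B).set := by
    rintro z (hz | ⟨y, hy, hyz⟩)
    · exact .inl (h hz)
    · exact .inr ⟨y, h hy, hyz⟩
  have hle (A : ISet (El X)) : A.set ⊆ (N A).set := fun z hz => .inl hz
  let S : ISet (El X) := ISet.empty.insert x
  have hxS : x ∈ S.set := .inl rfl
  -- The balls around `x`, as the least family that contains `{x}` and is closed under adding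
  -- neighbours; this replaces iteration along the natural numbers.
  let 𝓑 : ISet (ISet (El X)) := ISet.mk fun B => ∀ P : ISet (ISet (El X)), S ∈ P.set →
    (∀ A ∈ P.set, N'.1 A ∈ P.set) → B ∈ P.set
  have hS : S ∈ 𝓑.set := fun P h _ => h
  have hN : ∀ A ∈ 𝓑.set, N A ∈ 𝓑.set := fun A hA P h0 hs => hs A (hA P h0 hs)
  have hind {Φ : ISet (El X) → Prop} (hΦ : Pred Φ) (h0 : Φ S)
      (hs : ∀ A ∈ 𝓑.set, Φ A → Φ (N A)) : ∀ B ∈ 𝓑.set, Φ B := by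
    obtain ⟨P, hP⟩ : ∃ P : ISet (ISet (El X)), ∀ B, B ∈ P.set ↔ Φ B := ⟨ISet.mk Φ, fun _ => Iff.rfl⟩
    intro B hB
    have := hB (ISet.mk fun B => B ∈ P.set ∧ B ∈ 𝓑.set) ⟨(hP _).2 h0, hS⟩
      fun A hA => ⟨(hP _).2 (hs A hA.2 ((hP _).1 hA.1)), hN A hA.2⟩
    exact (hP _).1 this.1
  have hxB : ∀ B ∈ 𝓑.set, x ∈ B.set :=
    hind (Φ := fun B => x ∈ B.set) inferInstance hxS fun A _ h => hle A h
  have hSB : ∀ B ∈ 𝓑.set, S.set ⊆ B.set := fun B hB y hy =>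
    hy.elim (fun h => h ▸ hxB B hB) fun h => h.elim
  have hBfin : ∀ B ∈ 𝓑.set, IsFin B.set := by
    refine hind (Φ := fun B => IsFin B.set) inferInstance (IsFin.empty.insert x) fun A _ hA => ?_
    exact hA.union (hA.biUnion (Q := fun y z => (y, z) ∈ G.set) fun y _ => hfin y)
  -- Double induction showing that the balls form a chain: any ball is contained in `A` or contains
  -- the next ball `N A`.
  have hcmp : ∀ A ∈ 𝓑.set, ∀ B ∈ 𝓑.set, B.set ⊆ A.set ∨ (N A).set ⊆ B.set := by
    refine hind (Φ := fun A => ∀ B ∈ 𝓑.set, B.set ⊆ A.set ∨ (N'.1 A).set ⊆ B.set)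
      inferInstance ?_ ?_
    · refine hind (Φ := fun B => B.set ⊆ S.set ∨ (N'.1 S).set ⊆ B.set) inferInstance
        (.inl subset_rfl) fun B hB _ => .inr (hmono (hSB B hB))
    · intro A hA ih
      refine hind (Φ := fun B => B.set ⊆ (N'.1 A).set ∨ (N'.1 (N'.1 A)).set ⊆ B.set) inferInstance
        (.inl (hSB _ (hN A hA))) fun B hB h => ?_
      rcases h with h | h
      · rcases ih B hB with h' | h'
        · exact .inl (hmono h')
        · exact .inr (hmono h')
      · exact .inr (h.trans (hle B))
  have hU := hX.isFin_union_of_chain 𝓑 hBfin fun A hA B hB =>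
    (hcmp A hA B hB).symm.imp (fun h => (hle A).trans h) id
  refine ⟨ISet.mk fun y => ∃ B ∈ 𝓑.set, y ∈ B.set, hU, ⟨S, hS, hxS⟩, ?_⟩
  rintro y z hyz ⟨B, hB, hy⟩
  exact ⟨N B, hN B hB, .inr ⟨y, hy, hyz⟩⟩

/-- A locally finite graph on a strongly amorphous set has only finitely many edges. -/
theorem IsStronglyAmorphous.isFin_nonisolated (hX : IsStronglyAmorphous X)
    (G : ISet (El X × El X)) (hsymm : ∀ x y, (x, y) ∈ G.set → (y, x) ∈ G.set)
    (hfin : ∀ x, IsFin {y | (x, y) ∈ G.set}) :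
    IsFin {x | ∃ y, y ≠ x ∧ (x, y) ∈ G.set} := by
  -- The component of `x` is the intersection of all edge-closed sets that contain it.
  let C : El X → ISet (El X) := fun x => ISet.mk fun y => ∀ A : ISet (El X), x ∈ A.set →
    (∀ y z, (y, z) ∈ G.set → y ∈ A.set → z ∈ A.set) → y ∈ A.set
  have hCint : Internal C :=
    have : Pred fun p : El X × El X => p.2 ∈ (C p.1).set :=
      (inferInstance : Pred fun p : El X × El X => ∀ A : ISet (El X), p.1 ∈ A.set →
        (∀ y z, (y, z) ∈ G.set → y ∈ A.set → z ∈ A.set) → p.2 ∈ A.set)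
    Internal.iSet
  let C' : IFun (El X) (ISet (El X)) := IFun.mk C
  have hxC (x : El X) : x ∈ (C x).set := fun A hx _ => hx
  have hclosed (x y z : El X) (hyz : (y, z) ∈ G.set) (hy : y ∈ (C x).set) : z ∈ (C x).set :=
    fun A hx hA => hA y z hyz (hy A hx hA)
  have hsub {x y : El X} (h : y ∈ (C x).set) : (C y).set ⊆ (C x).set :=
    fun z hz => hz (C x) h (hclosed x)
  have hmem {x y : El X} (h : y ∈ (C x).set) : x ∈ (C y).set := by
    by_contra hx
    -- By symmetry of the graph, the complement of a component is edge-closed.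
    refine h (ISet.mk fun z => z ∉ (C y).set) hx (fun a b hab ha hb => ?_) (hxC y)
    exact ha (hclosed y b a (hsymm a b hab) hb)
  have hCfin (x : El X) : IsFin (C x).set := by
    obtain ⟨A, hA, hxA, hA'⟩ := hX.1.exists_isFin_closed G hfin x
    exact hA.subset fun y hy => hy A hxA hA'
  -- Strong rigidity is applied to the partition into components. A point with a neighbour other
  -- than itself lies in one of the finitely many nontrivial components, each of which is finite.
  let P : ISet (ISet (El X)) := ISet.mk fun A => ∃ x, A = C'.1 x
  have h1 : IsFin {A | A ∈ P.set ∧ ¬ ∃ x, A.set = {x}} := by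
    refine hX.2.2 P.set P.2 ?_ ?_ fun x => ⟨C x, ⟨x, rfl⟩, hxC x⟩
    · rintro A ⟨x, rfl⟩
      exact ⟨x, hxC x⟩
    · rintro A ⟨x, rfl⟩ B ⟨y, rfl⟩ hne
      refine Set.disjoint_left.2 fun z hzx hzy => hne (ISet.set_injective ?_)
      have e1 := (hsub hzx).antisymm (hsub (hmem hzx))
      have e2 := (hsub hzy).antisymm (hsub (hmem hzy))
      exact e1.symm.trans e2
  have h2 := h1.biUnion (Q := fun (A : ISet (El X)) x => x ∈ A.set) fun A hA => by
    obtain ⟨x, rfl⟩ := hA.1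
    exact hCfin x
  refine h2.subset ?_
  rintro x ⟨y, hyx, hxy⟩
  refine ⟨C x, ⟨⟨x, rfl⟩, ?_⟩, hxC x⟩
  rintro ⟨z, hz⟩
  have hx : x ∈ ({z} : Set (El X)) := hz ▸ hxC x
  have hy : y ∈ ({z} : Set (El X)) := hz ▸ hclosed x x y hxy (hxC x)
  exact hyx (hy.trans hx.symm)

end Rigid

section Structure

variable {V : Type*} [Membership V V] [ZF V]
variable {X R : V} [Field (El R)] [LinearOrder (El R)] [IsStrictOrderedRing (El R)]
variable [hR : Fact (IsRealField R)]

theorem fsum_congr {f g : El X → El R} [hf : Internal f] [hg : Internal g] {F : ISet (El X)}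
    (hF : IsFin F.set) (h : ∀ x ∈ F.set, f x = g x) : fsum f F = fsum g F := by
  obtain ⟨f', rfl⟩ : ∃ f' : IFun (El X) (El R), f'.1 = f := ⟨IFun.mk f, rfl⟩
  obtain ⟨g', rfl⟩ : ∃ f' : IFun (El X) (El R), f'.1 = g := ⟨IFun.mk g, rfl⟩
  refine ISet.induction (Φ := fun F => (∀ x ∈ F.set, f'.1 x = g'.1 x) →
    fsum f'.1 F = fsum g'.1 F) (by simp) ?_ hF h
  intro G x hG hx ih h
  rw [fsum_insert _ hG hx, fsum_insert _ hG hx, ih fun y hy => h y (.inr hy), h x (.inl rfl)]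

/-! ### Finite supports -/

/-- The number of elements of finite subsets of an infinite set takes all integer values. -/
theorem exists_card_near {S : ISet (El X)} (hS : ¬ IsFin S.set) {b : El R} (hb : 0 ≤ b) :
    ∃ F : ISet (El X), IsFin F.set ∧ F.set ⊆ S.set ∧ fsum (fun _ => (1 : El R)) F ≤ b ∧
      b < fsum (fun _ => (1 : El R)) F + 1 := by
  let L : ISet (El R) := ISet.mk fun t => ∃ F : ISet (El X), IsFin F.set ∧ F.set ⊆ S.set ∧
    fsum (fun _ => (1 : El R)) F = t ∧ t ≤ b
  obtain ⟨s, hs⟩ := hR.out.complete L.set L.2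
    ⟨0, ISet.empty, IsFin.empty, Set.empty_subset _, fsum_empty _, hb⟩
    ⟨b, by rintro _ ⟨F, _, _, _, h⟩; exact h⟩
  -- A cardinality above `s - 1`, where `s` is the supremum of the cardinalities at most `b`. One
  -- more point would exceed `s`, hence also `b`.
  obtain ⟨t, ⟨F, hF, hFS, rfl, hFb⟩, hst, -⟩ := hs.exists_between (sub_one_lt s)
  refine ⟨F, hF, hFS, hFb, ?_⟩
  by_contra! hlt
  obtain ⟨x, hxS, hxF⟩ : ∃ x ∈ S.set, x ∉ F.set := by
    by_contra! h
    exact hS (hF.subset h)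
  have := hs.1 ⟨F.insert x, hF.insert x, Set.insert_subset hxS hFS, fsum_insert _ hF hxF, hlt⟩
  linarith

theorem IsAmorphous.not_isFin_of_compl (hX : IsAmorphous X) {S : Set (El X)}
    (h : IsFin {x | ¬ x ∈ S}) : ¬ IsFin S := fun hS => hX.1 (by
  convert! hS.union h using 1
  ext x
  simp [em])

/-- The vectors of `ℓ²` of an amorphous set have finite support. -/
theorem IsAmorphous.isFin_support (hX : IsAmorphous X) (η : L2 X R) : IsFin {x | η x ≠ 0} := by
  obtain ⟨s, hs⟩ := hX.exists_isFin_ne fun x => absSq (η x)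
  by_cases h0 : s = 0
  · subst h0
    exact hs.subset fun x hx h => hx (absSq_eq_zero.1 h)
  exfalso
  let S : ISet (El X) := ISet.mk fun x => absSq (η x) = s
  have hS : ¬ IsFin S.set := hX.not_isFin_of_compl hs
  have hpos : 0 < s := by
    by_contra h
    refine hS (IsFin.empty.subset fun x hx => h ?_)
    have hx : absSq (η x) = s := hx
    exact lt_of_le_of_ne (hx ▸ absSq_nonneg _) (Ne.symm h0)
  obtain ⟨b, hb⟩ := η.summable
  have hb0 := hb.nonneg
  -- More than `b / s` points with `|η x|² = s` give a partial sum larger than `b`.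
  obtain ⟨F, hF, hFS, -, hlt⟩ := exists_card_near hS (b := b / s + 1) (by positivity)
  have h1 := sqSumLE_iff.1 hb F hF
  rw [fsum_congr (g := fun _ => s * 1) hF fun x hx => by rw [mul_one]; exact hFS hx,
    fsum_mul_left _ hF] at h1
  have h2 : b / s < fsum (fun _ => (1 : El R)) F := by linarith
  rw [div_lt_iff₀ hpos] at h2
  linarith

/-- A complex function on an amorphous set is constant up to finitely many points. -/
theorem IsAmorphous.exists_isFin_ne_cplx (hX : IsAmorphous X) (f : El X → Cplx R)
    [hf : Internal f] : ∃ c, IsFin {x | f x ≠ c} := by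
  obtain ⟨f, rfl⟩ : ∃ f' : IFun (El X) (Cplx R), f'.1 = f := ⟨IFun.mk f, rfl⟩
  obtain ⟨s, hs⟩ := hX.exists_isFin_ne fun x => (f.1 x).re
  obtain ⟨t, ht⟩ := hX.exists_isFin_ne fun x => (f.1 x).im
  refine ⟨⟨s, t⟩, (hs.union ht).subset fun x hx => ?_⟩
  by_contra h
  simp only [Set.mem_union, Set.mem_ofPred_eq, not_or, not_not] at h
  exact hx (QuadraticAlgebra.ext h.1 h.2)

/-! ### The matrix of an operator -/

/-- The matrix entry `⟨T e_y, e_x⟩`. -/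
noncomputable def Op.entry (T : Op X R) (x y : El X) : Cplx R := T (L2.single y 1) x

instance Internal.op_entry {α : Type*} [Coded V α] [Small α] {T : α → Op X R} {x y : α → El X}
    [Internal T] [Internal x] [Internal y] : Internal fun a => (T a).entry (x a) (y a) :=
  (inferInstance : Internal fun a => ((T a).toIFun.1 (L2.single (y a) 1)).toIFun.1 (x a))

instance Internal.op_entry_left {T : Op X R} {x : El X} : Internal (T.entry x) :=
  (inferInstance : Internal fun y => (T.toIFun.1 (L2.single y 1)).toIFun.1 x)

/-- The vector is the indicator of `F`, built one basis vector at a time so that linearity computes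
its image. It is the test vector for a row with infinitely many equal entries. -/
theorem exists_indicator (T : Op X R) (x : El X) (d : Cplx R) {F : ISet (El X)}
    (hF : IsFin F.set) : (∀ y ∈ F.set, T.entry x y = d) → ∃ η : L2 X R, (∀ y, y ∉ F.set → η y = 0) ∧
      SqSumLE η (fsum (fun _ => (1 : El R)) F) ∧
      T η x = d * ⟨fsum (fun _ => (1 : El R)) F, 0⟩ := by
  have : Internal fun p : ISet (El X) × L2 X R => (⟨fsum (fun _ => (1 : El R)) p.1, 0⟩ : Cplx R) :=
    Internal.cplx_mk
  refine ISet.induction (Φ := fun F => (∀ y ∈ F.set, T.entry x y = d) →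
    ∃ η : L2 X R, (∀ y, y ∉ F.set → η.toIFun.1 y = 0) ∧
      SqSumLE η.toIFun.1 (fsum (fun _ => (1 : El R)) F) ∧
      (T.toIFun.1 η).toIFun.1 x = d * ⟨fsum (fun _ => (1 : El R)) F, 0⟩) ?_ ?_ hF
  · intro _
    refine ⟨L2.zero, fun _ _ => rfl, sqSumLE_zero (by simp) fun _ => rfl, ?_⟩
    rw [T.map_zero (fun _ => rfl)]
    have : (⟨fsum (fun _ => (1 : El R)) (ISet.empty : ISet (El X)), 0⟩ : Cplx R) = 0 :=
      QuadraticAlgebra.ext (by simp) rfl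
    rw [this, mul_zero]
  · intro G y hG hy ih h
    obtain ⟨η, h0, hsum, hT⟩ := ih fun z hz => h z (.inr hz)
    -- The supports are disjoint, so squared moduli add.
    have hsplit (z : El X) : absSq (L2.lin 1 (L2.single y 1) η z) =
        absSq ((L2.single y (1 : Cplx R)) z) + absSq (η z) := by
      by_cases hz : z = y
      · subst hz
        simp [h0 z hy]
      · simp [L2.single_of_ne hz]
    refine ⟨L2.lin 1 (L2.single y 1) η, fun z hz => ?_, sqSumLE_iff.2 fun H hH => ?_, ?_⟩
    · show 1 * L2.single y 1 z + η z = 0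
      rw [L2.single_of_ne fun h => hz (.inl h), h0 z fun h => hz (.inr h)]
      ring
    · simp_rw [hsplit]
      rw [fsum_add hH, fsum_insert _ hG hy, add_comm]
      refine add_le_add (sqSumLE_iff.1 hsum H hH) ?_
      have := sqSumLE_iff.1 (sqSumLE_single y (1 : Cplx R)) H hH
      rw [absSq_one] at this
      exact this
    · refine (T.map_lin 1 (L2.single y 1) η x).trans ?_
      rw [hT, fsum_insert _ hG hy]
      have h1 : T (L2.single y 1) x = d := h y (.inl rfl)
      rw [h1]
      ext <;> simp only [QuadraticAlgebra.re_add, QuadraticAlgebra.im_add, QuadraticAlgebra.re_mul,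
        QuadraticAlgebra.im_mul, QuadraticAlgebra.re_one, QuadraticAlgebra.im_one] <;> ring

/-- The rows of the matrix of a bounded operator have finite support. -/
theorem IsAmorphous.isFin_row (hX : IsAmorphous X) {T : Op X R} (hT : T ∈ boundedOps X R)
    (x : El X) : IsFin {y | T.entry x y ≠ 0} := by
  obtain ⟨d, hd⟩ := hX.exists_isFin_ne_cplx fun y => T.entry x y
  by_cases h0 : d = 0
  · subst h0
    exact hd
  exfalso
  let S : ISet (El X) := ISet.mk fun y => T.entry x y = d
  have hS : ¬ IsFin S.set := hX.not_isFin_of_compl hd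
  obtain ⟨M, hM, hM'⟩ := hT
  have hd0 := absSq_pos h0
  set δ := absSq d with hδ
  -- Let `n` be the integer part of `c²`. Boundedness gives `δ n² ≤ M² c²`; as `n ≥ c² / 2` for `c ≥
  -- 2`, it follows that `δ c² ≤ 4 M²`. The choice of `c` makes `δ c² ≥ δ c = 2 δ + 4 M²`, a
  -- contradiction.
  obtain ⟨c, hc⟩ : ∃ c : El R, c = 2 + 4 * M ^ 2 / δ := ⟨_, rfl⟩
  have hc2 : 2 ≤ c := by rw [hc]; have : 0 ≤ 4 * M ^ 2 / δ := by positivity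
                         linarith
  obtain ⟨F, hF, hFS, hle, hlt⟩ := exists_card_near hS (b := c ^ 2) (by positivity)
  obtain ⟨η, -, hsum, hTη⟩ := exists_indicator T x d hF hFS
  set n := fsum (fun _ => (1 : El R)) F with hn
  have h1 := (hM' η c ⟨by linarith, hsum.mono hle⟩).apply_le x
  have h2 : absSq (T η x) = δ * n ^ 2 := by
    rw [hTη, absSq_mul, hδ]
    congr 1
    simp [absSq]
  have h1' : δ * n ^ 2 ≤ (M * c) ^ 2 := h2 ▸ h1
  have h3 : c ^ 2 / 2 ≤ n := by nlinarith
  have h4 : δ * (c ^ 2 / 2) ^ 2 ≤ δ * n ^ 2 := by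
    have : 0 ≤ c ^ 2 / 2 := by positivity
    gcongr
  have h5 : δ * (c ^ 2) ≤ 4 * M ^ 2 := by
    have hcc : 0 < c ^ 2 := by positivity
    have : δ * c ^ 2 * c ^ 2 ≤ 4 * M ^ 2 * c ^ 2 := by nlinarith
    exact le_of_mul_le_mul_right this hcc
  have h6 : δ * c = 2 * δ + 4 * M ^ 2 := by rw [hc]; field_simp
  have h7 : δ * c ≤ δ * c ^ 2 := by
    have : c ≤ c ^ 2 := by nlinarith
    gcongr
  linarith

/-! ### Operators that are scalar up to a finite matrix -/

/-- The operator `T` is the sum of `c1` and a matrix supported in `F × F`. -/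
def HasForm (T : Op X R) (F : ISet (El X)) (c : Cplx R) : Prop :=
  ∀ η : L2 X R, (∀ x, x ∉ F.set → T.toIFun.1 η x = c * η.toIFun.1 x) ∧
    ((∀ x ∈ F.set, η.toIFun.1 x = 0) → ∀ x, T.toIFun.1 η x = c * η.toIFun.1 x)

instance Pred.hasForm {α : Type*} [Coded V α] [Small α] {T : α → Op X R} {F : α → ISet (El X)}
    {c : α → Cplx R} [Internal T] [Internal F] [Internal c] :
    Pred fun a => HasForm (T a) (F a) (c a) := by
  have : Pred fun p : Op X R × ISet (El X) × Cplx R => HasForm p.1 p.2.1 p.2.2 := by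
    unfold HasForm
    infer_instance
  exact this.comp (f := fun a => (T a, F a, c a)) inferInstance

theorem HasForm.entry {T : Op X R} {F : ISet (El X)} {c : Cplx R} (h : HasForm T F c) {x y : El X}
    (hxy : x ∉ F.set ∨ y ∉ F.set) : T.entry x y = c * L2.single y 1 x := by
  rcases hxy with hx | hy
  · exact (h _).1 x hx
  · exact (h (L2.single y 1)).2 (fun z hz => L2.single_of_ne (by rintro rfl; exact hy hz) 1) x

/-- Vectors are finite combinations of basis vectors, so an operator is determined by its matrix
algebraically, without continuity. -/
theorem IsAmorphous.hasForm (hX : IsAmorphous X) {T : Op X R} {F : ISet (El X)} {c : Cplx R}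
    (h : ∀ x y, x ∉ F.set ∨ y ∉ F.set → T.entry x y = c * L2.single y 1 x) : HasForm T F c := by
  intro η
  have key : ∀ η : L2 X R, (∀ x, x ∉ {x | η.toIFun.1 x ≠ 0} → η.toIFun.1 x = 0) →
      (∀ x, x ∉ F.set → T.toIFun.1 η x = c * η.toIFun.1 x) ∧
      ((∀ x ∈ F.set, η.toIFun.1 x = 0) → ∀ x, T.toIFun.1 η x = c * η.toIFun.1 x) := by
    intro η
    refine IsFin.induction (Φ := fun H => ∀ η : L2 X R, (∀ x, x ∉ H → η.toIFun.1 x = 0) →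
      (∀ x, x ∉ F.set → (T.toIFun.1 η).toIFun.1 x = c * η.toIFun.1 x) ∧
      ((∀ x ∈ F.set, η.toIFun.1 x = 0) → ∀ x, (T.toIFun.1 η).toIFun.1 x = c * η.toIFun.1 x))
      ?_ ?_ (hX.isFin_support η) η
    · intro η h0
      have h0' : ∀ x, η x = 0 := fun x => h0 x (Set.notMem_empty x)
      have (x : El X) : T η x = c * η x := by rw [T.map_zero h0', h0', mul_zero]
      exact ⟨fun x _ => this x, fun _ x => this x⟩
    · intro H y _ hy ih η h0
      -- `ζ` is `η` with its coordinate at `y` set to zero.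
      set ζ : L2 X R := L2.lin (- η y) (L2.single y 1) η with hζ
      have hζ' (x : El X) : ζ x = - η y * L2.single y 1 x + η x := rfl
      have hdecomp (x : El X) : η x = η y * L2.single y 1 x + ζ x := by rw [hζ']; ring
      have hT (x : El X) : T η x = η y * T.entry x y + T ζ x := T.linear _ _ _ _ hdecomp x
      obtain ⟨h1, h2⟩ := ih ζ fun x hx => by
        show ζ x = 0
        by_cases hxy : x = y
        · subst hxy
          simp [hζ']
        · rw [hζ', L2.single_of_ne hxy, h0 x fun h => h.elim hxy hx]
          ring
      refine ⟨fun x hx => ?_, fun hη x => ?_⟩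
      · refine (hT x).trans ?_
        rw [h x y (.inl hx), h1 x hx]
        show _ = c * η x
        rw [hdecomp x]
        ring
      · refine (hT x).trans ?_
        have hζF : ∀ z ∈ F.set, ζ z = 0 := fun z hz => by
          by_cases hzy : z = y
          · subst hzy
            simp [hζ']
          · rw [hζ', L2.single_of_ne hzy, hη z hz]
            ring
        rw [h2 hζF x]
        by_cases hyF : y ∈ F.set
        · have : η y = 0 := hη y hyF
          rw [this, zero_mul, zero_add]
          show _ = c * η x
          rw [hdecomp x, this, zero_mul, zero_add]
        · rw [h x y (.inr hyF)]
          show _ = c * η x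
          rw [hdecomp x]
          ring
  exact key η fun x hx => not_not.1 hx

/-- Every bounded operator is scalar up to a finite matrix. -/
theorem IsStronglyAmorphous.exists_hasForm (hX : IsStronglyAmorphous X) {T : Op X R}
    (hT : T ∈ boundedOps X R) : ∃ (F : ISet (El X)) (c : Cplx R), IsFin F.set ∧ HasForm T F c := by
  let G : ISet (El X × El X) := ISet.mk fun p => T.entry p.1 p.2 ≠ 0 ∨ T.entry p.2 p.1 ≠ 0
  -- Local finiteness: the neighbours of `x` come from row `x`, finite by boundedness, and from
  -- column `x`, the support of `T e_x`.
  have h1 := hX.isFin_nonisolated G (fun x y h => Or.symm h) fun x =>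
    (hX.1.isFin_row hT x).union (hX.1.isFin_support (T (L2.single x 1)))
  obtain ⟨c, h2⟩ := hX.1.exists_isFin_ne_cplx fun x => T.entry x x
  obtain ⟨F, hF⟩ := (h1.union h2).exists_iSet
  refine ⟨F, c, hF ▸ h1.union h2, hX.1.hasForm fun x y hxy => ?_⟩
  by_cases h : x = y
  · subst h
    rw [L2.single_self, mul_one]
    by_contra hc
    have : x ∈ F.set := hF ▸ .inr hc
    tauto
  · rw [L2.single_of_ne h, mul_zero]
    by_contra hc
    have hx : x ∈ F.set := hF ▸ .inl ⟨y, Ne.symm h, .inl hc⟩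
    have hy : y ∈ F.set := hF ▸ .inl ⟨x, h, .inr hc⟩
    tauto

end Structure

section Structure

variable {V : Type*} [Membership V V] [ZF V]
variable {X R : V} [Field (El R)] [LinearOrder (El R)] [IsStrictOrderedRing (El R)]
variable [hR : Fact (IsRealField R)]

/-! ### Algebra of scalars plus finite matrices -/

theorem HasForm.mono {T : Op X R} {F G : ISet (El X)} {c : Cplx R} (h : HasForm T F c)
    (hFG : F.set ⊆ G.set) : HasForm T G c := fun η =>
  ⟨fun x hx => (h η).1 x fun hx' => hx (hFG hx'), fun h0 => (h η).2 fun x hx => h0 x (hFG hx)⟩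

theorem HasForm.lin {S T : Op X R} {F : ISet (El X)} {a b : Cplx R} (hS : HasForm S F a)
    (hT : HasForm T F b) (c : Cplx R) : HasForm (Op.lin c S T) F (c * a + b) := fun η => by
  refine ⟨fun x hx => ?_, fun h0 x => ?_⟩
  · refine (Op.lin_apply c S T η x).trans ?_
    rw [(hS η).1 x hx, (hT η).1 x hx]
    ring
  · refine (Op.lin_apply c S T η x).trans ?_
    rw [(hS η).2 h0 x, (hT η).2 h0 x]
    ring

theorem HasForm.comp {S T : Op X R} {F : ISet (El X)} {a b : Cplx R} (hS : HasForm S F a)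
    (hT : HasForm T F b) : HasForm (S.comp T) F (a * b) := fun η => by
  refine ⟨fun x hx => ?_, fun h0 x => ?_⟩
  · refine ((hS (T η)).1 x hx).trans ?_
    rw [(hT η).1 x hx, mul_assoc]
  · refine ((hS (T η)).2 (fun y hy => ?_) x).trans ?_
    · rw [(hT η).2 h0 y, h0 y hy, mul_zero]
    · rw [(hT η).2 h0 x, mul_assoc]

theorem hasForm_id (F : ISet (El X)) : HasForm (Op.id : Op X R) F 1 := fun η =>
  ⟨fun x _ => (one_mul (η x)).symm, fun _ x => (one_mul (η x)).symm⟩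

theorem hasForm_zero (F : ISet (El X)) : HasForm (Op.zero : Op X R) F 0 := fun η =>
  ⟨fun x _ => (zero_mul (η x)).symm, fun _ x => (zero_mul (η x)).symm⟩

theorem hasForm_unit {F : ISet (El X)} {x y : El X} (hx : x ∈ F.set) (hy : y ∈ F.set) :
    HasForm (Op.unit x y : Op X R) F 0 := fun η => by
  refine ⟨fun w hw => ?_, fun h0 w => ?_⟩
  · rw [zero_mul]
    exact L2.single_of_ne (by rintro rfl; exact hw hx) _
  · rw [zero_mul]
    show L2.single x (η y) w = 0
    rw [h0 y hy]
    by_cases h : w = x <;> simp [L2.single_apply, h]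

theorem Op.entry_lin (c : Cplx R) (S T : Op X R) (x y : El X) :
    (Op.lin c S T).entry x y = c * S.entry x y + T.entry x y := rfl

open Classical in
theorem Op.entry_unit (x y u v : El X) :
    (Op.unit x y : Op X R).entry u v = if u = x ∧ v = y then 1 else 0 := by
  show L2.single x (L2.single v 1 y) u = _
  by_cases hu : u = x <;> by_cases hv : v = y <;>
    simp [L2.single_apply, hu, hv, eq_comm (a := y)]

/-- Matrices supported in `F × F` arise from zero by adding multiples of matrix units. Boundedness,
compactness, adjoints and finite dimension are all reduced to matrix units in this way. -/
theorem HasForm.induction (hX : IsAmorphous X) {F : ISet (El X)} (hF : IsFin F.set)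
    {Φ : Op X R → Prop} [hΦ : Pred Φ] (h0 : Φ Op.zero)
    (hs : ∀ x ∈ F.set, ∀ y ∈ F.set, ∀ (z : Cplx R) (K : Op X R), Φ K →
      Φ (Op.lin z (Op.unit x y) K)) {K : Op X R} (hK : HasForm K F 0) : Φ K := by
  obtain ⟨U, hU⟩ : ∃ U : ISet (Op X R), ∀ K, K ∈ U.set ↔ Φ K := ⟨ISet.mk Φ, fun _ => Iff.rfl⟩
  refine (hU K).1 (IsFin.induction (Φ := fun H : Set (El X × El X) =>
    (∀ p ∈ H, p.1 ∈ F.set ∧ p.2 ∈ F.set) →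
    ∀ K : Op X R, (∀ p, p ∉ H → K.entry p.1 p.2 = 0) → K ∈ U.set) ?_ ?_ (hF.prod hF) ?_ K ?_)
  · intro _ K hK
    have : HasForm K ISet.empty 0 := hX.hasForm fun x y _ => by
      rw [zero_mul]
      exact hK (x, y) (Set.notMem_empty _)
    rw [show K = Op.zero from Op.ext fun η x => by
      rw [(this η).1 x (Set.notMem_empty x), zero_mul]
      rfl]
    exact (hU _).2 h0
  · intro H p _ hp ih hHF K hK
    -- Clearing the entry at `p` leaves a matrix supported in `H`.
    have h1 : Op.lin (-K.entry p.1 p.2) (Op.unit p.1 p.2) K ∈ U.set := by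
      refine ih (fun q hq => hHF q (.inr hq)) _ fun q hq => ?_
      rw [Op.entry_lin, Op.entry_unit]
      by_cases hqp : q = p
      · subst hqp
        simp
      · rw [if_neg fun h => hqp (Prod.ext h.1 h.2), hK q fun h => h.elim hqp hq]
        ring
    have h2 := hs p.1 (hHF p (.inl rfl)).1 p.2 (hHF p (.inl rfl)).2 (K.entry p.1 p.2) _
      ((hU _).1 h1)
    rw [hU]
    convert! h2 using 1
    refine Op.ext fun η x => ?_
    simp only [Op.lin_apply]
    ring
  · exact fun p hp => hp
  · intro p hp
    refine (hK.entry ?_).trans (zero_mul _)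
    by_contra! h
    exact hp h

theorem Op.scalar_add_sub_scalar (c : Cplx R) (T : Op X R) :
    Op.lin c Op.id (Op.lin (-c) Op.id T) = T := Op.ext fun η x => by
  simp only [Op.lin_apply]
  ring

theorem HasForm.sub_scalar {T : Op X R} {F : ISet (El X)} {c : Cplx R} (hT : HasForm T F c) :
    HasForm (Op.lin (-c) Op.id T) F 0 := by
  have := (hasForm_id F).lin hT (-c)
  rwa [mul_one, neg_add_cancel] at this

theorem HasForm.mem_boundedOps (hX : IsAmorphous X) {F : ISet (El X)} (hF : IsFin F.set)
    {T : Op X R} {c : Cplx R} (hT : HasForm T F c) : T ∈ boundedOps X R := by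
  rw [← Op.scalar_add_sub_scalar c T]
  refine lin_mem_boundedOps id_mem_boundedOps ?_ c
  exact hT.sub_scalar.induction hX hF (Φ := fun K => K ∈ boundedOps X R) zero_mem_boundedOps
    fun _ _ _ _ z _ h => lin_mem_boundedOps (unit_mem_boundedOps _ _) h z

/-! ### Inner products -/

theorem fsum_eq_of_subset {g : El X → Cplx R} [hg : Internal g] {F G : ISet (El X)}
    (hG : IsFin G.set) (hFG : F.set ⊆ G.set) (h : ∀ x, x ∉ F.set → g x = 0) :
    fsum g G = fsum g F := by
  obtain ⟨g, rfl⟩ : ∃ f : IFun (El X) (Cplx R), f.1 = g := ⟨IFun.mk g, rfl⟩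
  -- `F` is replaced by `G ∩ F`, which varies with `G` during the induction.
  have key : ∀ H : ISet (El X), (∀ x, x ∈ H.set ↔ x ∈ G.set ∧ x ∈ F.set) →
      fsum g.1 G = fsum g.1 H := by
    refine ISet.induction (Φ := fun G => ∀ H : ISet (El X),
      (∀ x, x ∈ H.set ↔ x ∈ G.set ∧ x ∈ F.set) → fsum g.1 G = fsum g.1 H) ?_ ?_ hG
    · intro H hH
      rw [show H = ISet.empty from ISet.ext fun x =>
        ⟨fun hx => ((hH x).1 hx).1, fun hx => (Set.notMem_empty x hx).elim⟩]
    · intro G x hG hx ih H hH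
      have hG' : IsFin (ISet.mk fun y => y ∈ G.set ∧ y ∈ F.set).set :=
        hG.subset fun y hy => hy.1
      rw [fsum_insert _ hG hx, ih (ISet.mk fun y => y ∈ G.set ∧ y ∈ F.set) fun y => Iff.rfl]
      by_cases hxF : x ∈ F.set
      · rw [← fsum_insert _ hG' fun h => hx h.1]
        congr 1
        refine ISet.ext fun y => (Iff.trans ?_ (hH y).symm)
        constructor
        · rintro (rfl | hy)
          · exact ⟨.inl rfl, hxF⟩
          · exact ⟨.inr hy.1, hy.2⟩
        · rintro ⟨rfl | hy, hyF⟩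
          · exact .inl rfl
          · exact .inr ⟨hy, hyF⟩
      · rw [h x hxF, add_zero]
        congr 1
        refine ISet.ext fun y => (Iff.trans ?_ (hH y).symm)
        constructor
        · exact fun hy => ⟨.inr hy.1, hy.2⟩
        · rintro ⟨rfl | hy, hyF⟩
          · exact (hxF hyF).elim
          · exact ⟨hy, hyF⟩
  exact key F fun x => ⟨fun hx => ⟨hFG hx, hx⟩, fun hx => hx.2⟩

theorem fsum_lin {f g : El X → Cplx R} [hf : Internal f] [hg : Internal g] {F : ISet (El X)}
    (hF : IsFin F.set) (c : Cplx R) : fsum (fun x => c * f x + g x) F = c * fsum f F + fsum g F := by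
  obtain ⟨f', rfl⟩ : ∃ f' : IFun (El X) (Cplx R), f'.1 = f := ⟨IFun.mk f, rfl⟩
  obtain ⟨g', rfl⟩ : ∃ f' : IFun (El X) (Cplx R), f'.1 = g := ⟨IFun.mk g, rfl⟩
  refine ISet.induction (Φ := fun F => fsum (fun x => c * f'.1 x + g'.1 x) F =
    c * fsum f'.1 F + fsum g'.1 F) (by simp) ?_ hF
  intro G x hG hx ih
  rw [fsum_insert _ hG hx, fsum_insert _ hG hx, fsum_insert _ hG hx, ih]
  ring

theorem fsum_star {f : El X → Cplx R} [hf : Internal f] {F : ISet (El X)}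
    (hF : IsFin F.set) : fsum (fun x => star (f x)) F = star (fsum f F) := by
  obtain ⟨f', rfl⟩ : ∃ f' : IFun (El X) (Cplx R), f'.1 = f := ⟨IFun.mk f, rfl⟩
  refine ISet.induction (Φ := fun F => fsum (fun x => star (f'.1 x)) F = star (fsum f'.1 F))
    ?_ ?_ hF
  · rw [fsum_empty, fsum_empty, star_zero']
  intro G x hG hx ih
  rw [fsum_insert _ hG hx, fsum_insert _ hG hx, ih, star_add']

/-- The partial sums are constant once they include `F`, so convergence reduces to a finite sum. -/
theorem isInner_iff {η ζ : L2 X R} {F : ISet (El X)} (hF : IsFin F.set)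
    (h : ∀ x, x ∉ F.set → η x * star (ζ x) = 0) {c : Cplx R} :
    IsInner η ζ c ↔ fsum (fun x => η x * star (ζ x)) F = c := by
  constructor
  · intro hc
    rw [← sub_eq_zero, ← absSq_eq_zero]
    refine le_antisymm (le_of_forall_pos_le_add fun ε hε => ?_) (absSq_nonneg _)
    obtain ⟨G, hG, hG'⟩ := hc ε hε
    obtain ⟨H, hH⟩ := (hG.union hF).exists_iSet
    have hHfin : IsFin H.set := hH ▸ hG.union hF
    have := hG' H _ (hH ▸ Set.subset_union_left) (isFinSum_fsum _ hHfin)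
    rw [fsum_eq_of_subset hHfin (hH ▸ Set.subset_union_right) h] at this
    rwa [zero_add]
  · rintro rfl ε hε
    refine ⟨F, hF, fun G s hFG hs => ?_⟩
    rw [← hs.fsum_eq, fsum_eq_of_subset hs.isFin hFG h, sub_self, absSq_zero]
    exact hε.le

section Inner

variable {η θ ζ : L2 X R} {a b : Cplx R}

theorem IsAmorphous.exists_isInner_iff (hX : IsAmorphous X) (η ζ : L2 X R) :
    ∃ a : Cplx R, ∀ c, IsInner η ζ c ↔ a = c := by
  obtain ⟨F, hF⟩ := (hX.isFin_support η).exists_iSet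
  refine ⟨_, fun c => isInner_iff (hF ▸ hX.isFin_support η) fun x hx => ?_⟩
  have : η x = 0 := by
    by_contra h0
    exact hx (hF ▸ h0)
  rw [this, zero_mul]

theorem IsInner.unique (hX : IsAmorphous X) (ha : IsInner η ζ a) (hb : IsInner η ζ b) : a = b := by
  obtain ⟨d, hd⟩ := hX.exists_isInner_iff η ζ
  rw [← (hd a).1 ha, (hd b).1 hb]

theorem IsInner.symm (hX : IsAmorphous X) (h : IsInner η ζ a) : IsInner ζ η (star a) := by
  obtain ⟨F, hF⟩ := (hX.isFin_support η).exists_iSet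
  have hFfin : IsFin F.set := hF ▸ hX.isFin_support η
  have h0 : ∀ x, x ∉ F.set → η x = 0 := fun x hx => by
    by_contra h0
    exact hx (hF ▸ h0)
  rw [isInner_iff hFfin fun x hx => by rw [h0 x hx, zero_mul]] at h
  rw [isInner_iff hFfin fun x hx => by rw [h0 x hx, star_zero', mul_zero], ← h, ← fsum_star hFfin]
  refine congrArg (fsum · F) (funext fun x => ?_)
  rw [star_mul', star_star', mul_comm]

theorem IsInner.lin (hX : IsAmorphous X) (ha : IsInner η ζ a) (hb : IsInner θ ζ b) (c : Cplx R) :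
    IsInner (L2.lin c η θ) ζ (c * a + b) := by
  obtain ⟨F, hF⟩ := (hX.isFin_support ζ).exists_iSet
  have hFfin : IsFin F.set := hF ▸ hX.isFin_support ζ
  have h0 : ∀ (η : L2 X R) x, x ∉ F.set → η x * star (ζ x) = 0 := fun η x hx => by
    have : ζ x = 0 := by
      by_contra h0
      exact hx (hF ▸ h0)
    rw [this, star_zero', mul_zero]
  rw [isInner_iff hFfin (h0 _)] at ha hb ⊢
  rw [← ha, ← hb, ← fsum_lin hFfin]
  refine congrArg (fsum · F) (funext fun x => ?_)
  rw [L2.lin_apply]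
  ring

theorem isInner_single (x : El X) (z : Cplx R) (ζ : L2 X R) :
    IsInner (L2.single x z) ζ (z * star (ζ x)) := by
  have hF : IsFin (ISet.empty.insert x).set := IsFin.empty.insert x
  refine (isInner_iff hF fun y hy => ?_).2 ?_
  · rw [L2.single_of_ne fun h => hy (.inl h), zero_mul]
  · rw [fsum_insert _ IsFin.empty (Set.notMem_empty x), fsum_empty, zero_add, L2.single_self]

theorem isInner_zero (h : ∀ x, η x * star (ζ x) = 0) : IsInner η ζ 0 :=
  (isInner_iff IsFin.empty fun x _ => h x).2 (fsum_empty _)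

end Inner

/-- Inner products are unique, so a common value on both sides is enough. -/
theorem isAdjoint_of_exists (hX : IsAmorphous X) {S T : Op X R}
    (h : ∀ η ζ : L2 X R, ∃ c, IsInner (S η) ζ c ∧ IsInner η (T ζ) c) : IsAdjoint S T := by
  intro η ζ c
  obtain ⟨d, h1, h2⟩ := h η ζ
  exact ⟨fun hc => h1.unique hX hc ▸ h2, fun hc => h2.unique hX hc ▸ h1⟩

theorem isAdjoint_id : IsAdjoint (Op.id : Op X R) Op.id := fun _ _ _ => Iff.rfl

theorem isAdjoint_zero (hX : IsAmorphous X) : IsAdjoint (Op.zero : Op X R) Op.zero :=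
  isAdjoint_of_exists hX fun _ _ => ⟨0, isInner_zero fun _ => zero_mul _,
    isInner_zero fun x => by
      rw [Op.zero_apply, L2.zero_apply, star_zero', mul_zero]⟩

theorem isAdjoint_unit (hX : IsAmorphous X) (x y : El X) :
    IsAdjoint (Op.unit x y : Op X R) (Op.unit y x) :=
  isAdjoint_of_exists hX fun η ζ => ⟨η y * star (ζ x), isInner_single x (η y) ζ, by
    have := (isInner_single y (ζ x) η).symm hX
    rwa [star_mul', star_star', mul_comm] at this⟩

theorem IsAdjoint.lin (hX : IsAmorphous X) {S S' T T' : Op X R} (hS : IsAdjoint S S')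
    (hT : IsAdjoint T T') (c : Cplx R) : IsAdjoint (Op.lin c S T) (Op.lin (star c) S' T') :=
  isAdjoint_of_exists hX fun η ζ => by
    obtain ⟨a, ha⟩ := hX.exists_isInner_iff (S η) ζ
    obtain ⟨b, hb⟩ := hX.exists_isInner_iff (T η) ζ
    have ha1 := (ha a).2 rfl
    have hb1 := (hb b).2 rfl
    refine ⟨c * a + b, ha1.lin hX hb1 c, ?_⟩
    have := ((((hS η ζ a).1 ha1).symm hX).lin hX (((hT η ζ b).1 hb1).symm hX) (star c)).symm hX
    rwa [star_add', star_mul', star_star', star_star', star_star'] at this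

instance Pred.isInner {α : Type*} [Coded V α] [Small α] {η ζ : α → L2 X R} {c : α → Cplx R}
    [Internal η] [Internal ζ] [Internal c] : Pred fun a => IsInner (η a) (ζ a) (c a) := by
  have : Pred fun p : L2 X R × L2 X R × Cplx R => IsInner p.1 p.2.1 p.2.2 := by
    unfold IsInner
    infer_instance
  exact this.comp (f := fun a => (η a, ζ a, c a)) inferInstance

instance Pred.isAdjoint {α : Type*} [Coded V α] [Small α] {S T : α → Op X R}
    [Internal S] [Internal T] : Pred fun a => IsAdjoint (S a) (T a) := by
  have : Pred fun p : Op X R × Op X R => ∀ (η ζ : L2 X R) (c : Cplx R),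
      IsInner (p.1.toIFun.1 η) ζ c ↔ IsInner η (p.2.toIFun.1 ζ) c := inferInstance
  exact this.comp (f := fun a => (S a, T a)) inferInstance

theorem HasForm.exists_isAdjoint (hX : IsAmorphous X) {F : ISet (El X)} (hF : IsFin F.set)
    {T : Op X R} {c : Cplx R} (hT : HasForm T F c) : ∃ T', HasForm T' F (star c) ∧ IsAdjoint T T' := by
  obtain ⟨K', h1, h2⟩ := hT.sub_scalar.induction hX hF
    (Φ := fun K => ∃ K', HasForm K' F 0 ∧ IsAdjoint K K')
    ⟨Op.zero, hasForm_zero F, isAdjoint_zero hX⟩ fun x hx y hy z K ⟨K', h1, h2⟩ =>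
      ⟨Op.lin (star z) (Op.unit y x) K', by
        have := (hasForm_unit hy hx).lin h1 (star z)
        rwa [mul_zero, zero_add] at this, (isAdjoint_unit hX x y).lin hX h2 z⟩
  refine ⟨Op.lin (star c) Op.id K', ?_, ?_⟩
  · have := (hasForm_id F).lin h1 (star c)
    rwa [mul_one, add_zero] at this
  · have := isAdjoint_id.lin hX h2 c
    rwa [Op.scalar_add_sub_scalar] at this

end Structure

section Compact

variable {V : Type*} [Membership V V] [ZF V]
variable {X R : V} [Field (El R)] [LinearOrder (El R)] [IsStrictOrderedRing (El R)]
variable [hR : Fact (IsRealField R)]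

/-! ### Compact operators -/

/-- Balls are sets of the model and every bounded set lies in one, so only balls need testing. In
this form compactness is an internal predicate. -/
theorem mem_compactOps_iff {T : Op X R} : T ∈ compactOps X R ↔ ∀ b ε : El R, 0 < ε →
    ∃ F : ISet (L2 X R), IsFin F.set ∧ ∀ η : L2 X R, NormLE η.toIFun.1 b →
      ∃ ζ ∈ F.set, NormLE (fun x => (T.toIFun.1 η).toIFun.1 x - ζ.toIFun.1 x) ε := by
  constructor
  · intro hT b ε hε
    let A : ISet (L2 X R) := ISet.mk fun η => NormLE η.toIFun.1 b
    obtain ⟨F, hF, h⟩ := hT A.set A.2 ⟨b, fun η hη => hη⟩ ε hε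
    obtain ⟨F, rfl⟩ := hF.exists_iSet
    exact ⟨F, hF, fun η hη => h _ ⟨η, hη, rfl⟩⟩
  · rintro hT A - ⟨b, hb⟩ ε hε
    obtain ⟨F, hF, h⟩ := hT b ε hε
    refine ⟨F.set, hF, ?_⟩
    rintro _ ⟨η, hη, rfl⟩
    exact h η (hb η hη)

instance Pred.compactOps : Pred fun T : Op X R => T ∈ compactOps X R :=
  (inferInstance : Pred fun T : Op X R => ∀ b ε : El R, 0 < ε →
    ∃ F : ISet (L2 X R), IsFin F.set ∧ ∀ η : L2 X R, NormLE η.toIFun.1 b →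
      ∃ ζ ∈ F.set, NormLE (fun x => (T.toIFun.1 η).toIFun.1 x - ζ.toIFun.1 x) ε).congr
    fun _ => mem_compactOps_iff.symm

theorem zero_mem_compactOps : (Op.zero : Op X R) ∈ compactOps X R :=
  mem_compactOps_iff.2 fun _ _ hε => ⟨ISet.empty.insert L2.zero, IsFin.empty.insert _, fun _ _ =>
    ⟨L2.zero, .inl rfl, normLE_zero hε.le fun _ => sub_self _⟩⟩

theorem lin_mem_compactOps {S T : Op X R} (hS : S ∈ compactOps X R) (hT : T ∈ compactOps X R)
    (c : Cplx R) : Op.lin c S T ∈ compactOps X R := by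
  rw [mem_compactOps_iff] at hS hT ⊢
  intro b ε hε
  obtain ⟨r, hr, hc⟩ := exists_absSq_le c
  obtain ⟨F, hF, hFS⟩ := hS b (ε / (2 * r)) (by positivity)
  obtain ⟨G, hG, hGT⟩ := hT b (ε / 2) (by positivity)
  obtain ⟨H, hH⟩ := ((hF.prod hG).image fun p => L2.lin c p.1 p.2).exists_iSet
  refine ⟨H, hH ▸ (hF.prod hG).image fun p => L2.lin c p.1 p.2, fun η hη => ?_⟩
  obtain ⟨ζ, hζ, h1⟩ := hFS η hη
  obtain ⟨θ, hθ, h2⟩ := hGT η hη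
  refine ⟨L2.lin c ζ θ, hH ▸ ⟨(ζ, θ), ⟨hζ, hθ⟩, rfl⟩, ?_⟩
  have h3 := (h1.mul hr.le hc).add h2
  have h4 : r * (ε / (2 * r)) + ε / 2 = ε := by field_simp; ring
  rw [h4] at h3
  convert! h3 using 2 with x
  show c * S η x + T η x - (c * ζ x + θ x) = c * (S η x - ζ x) + (T η x - θ x)
  ring

/-- Bounded intervals are totally bounded. -/
theorem exists_net (a b : El R) {δ : El R} (hδ : 0 < δ) : ∃ N : ISet (El R), IsFin N.set ∧
    ∀ t, a ≤ t → t ≤ b → ∃ s ∈ N.set, s ≤ t ∧ t ≤ s + δ := by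
  -- The right endpoints `u` for which `[a, u]` has a finite net are closed under adding `δ`. If `b`
  -- were not among them, they would be bounded by `b`, and their supremum would be exceeded.
  let L : ISet (El R) := ISet.mk fun u => ∃ N : ISet (El R), IsFin N.set ∧
    ∀ t, a ≤ t → t ≤ u → ∃ s ∈ N.set, s ≤ t ∧ t ≤ s + δ
  have hstep : ∀ u ∈ L.set, u + δ ∈ L.set := by
    rintro u ⟨N, hN, h⟩
    refine ⟨N.insert u, hN.insert u, fun t hat htu => ?_⟩
    rcases le_total t u with h' | h'
    · obtain ⟨s, hs, hst⟩ := h t hat h'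
      exact ⟨s, .inr hs, hst⟩
    · exact ⟨u, .inl rfl, h', htu⟩
  by_contra hb
  have hub : ∀ u ∈ L.set, u ≤ b := by
    rintro u ⟨N, hN, h⟩
    by_contra! hbu
    exact hb ⟨N, hN, fun t hat htb => h t hat (htb.trans hbu.le)⟩
  obtain ⟨s, hs⟩ := hR.out.complete L.set L.2
    ⟨a, ISet.empty.insert a, IsFin.empty.insert a, fun t hat hta =>
      ⟨a, .inl rfl, hat, hta.trans (by linarith)⟩⟩ ⟨b, hub⟩
  obtain ⟨u, hu, hsu, -⟩ := hs.exists_between (sub_lt_self s hδ)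
  have := hs.1 (hstep u hu)
  linarith

theorem unit_mem_compactOps (x y : El X) : (Op.unit x y : Op X R) ∈ compactOps X R := by
  rw [mem_compactOps_iff]
  intro b ε hε
  have : Internal fun p : El R × El R => (⟨p.1, p.2⟩ : Cplx R) := Internal.cplx_mk
  -- The image of a ball lies in a disc in one coordinate. A grid of mesh `ε / 2` in both real and
  -- imaginary part has squared error at most `ε² / 2`.
  obtain ⟨N, hN, h⟩ := exists_net (-b) b (half_pos hε)
  have hfin := (hN.prod hN).image fun p => L2.single x (⟨p.1, p.2⟩ : Cplx R)
  obtain ⟨F, hF⟩ := hfin.exists_iSet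
  refine ⟨F, hF ▸ hfin, fun η hη => ?_⟩
  have hb := hη.1
  have h1 : (η y).re ^ 2 + (η y).im ^ 2 ≤ b ^ 2 := hη.apply_le y
  have hre := abs_le_of_sq_le_sq' (show (η y).re ^ 2 ≤ b ^ 2 by nlinarith) hb
  have him := abs_le_of_sq_le_sq' (show (η y).im ^ 2 ≤ b ^ 2 by nlinarith) hb
  obtain ⟨s, hs, hs1, hs2⟩ := h _ hre.1 hre.2
  obtain ⟨t, ht, ht1, ht2⟩ := h _ him.1 him.2
  refine ⟨L2.single x ⟨s, t⟩, hF ▸ ⟨(s, t), ⟨hs, ht⟩, rfl⟩, ?_⟩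
  have hd : absSq (η y - ⟨s, t⟩) ≤ ε ^ 2 := by
    show ((η y).re - s) ^ 2 + ((η y).im - t) ^ 2 ≤ ε ^ 2
    nlinarith
  convert! normLE_single (x := x) hε.le hd using 2 with w
  show L2.single x (η y) w - _ = _
  by_cases hw : w = x <;> simp [L2.single_apply, hw]

theorem HasForm.mem_compactOps (hX : IsAmorphous X) {F : ISet (El X)} (hF : IsFin F.set)
    {K : Op X R} (hK : HasForm K F 0) : K ∈ compactOps X R :=
  hK.induction hX hF (Φ := fun K => K ∈ compactOps X R) zero_mem_compactOps
    fun _ _ _ _ z _ h => lin_mem_compactOps (unit_mem_compactOps _ _) h z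

theorem exists_normLE_of_isFin {F : ISet (L2 X R)} (hF : IsFin F.set) :
    ∃ M : El R, ∀ ζ ∈ F.set, NormLE ζ.toIFun.1 M := by
  refine ISet.induction (Φ := fun F : ISet (L2 X R) => ∃ M : El R, ∀ ζ ∈ F.set, NormLE ζ.toIFun.1 M) ?_ ?_ hF
  · exact ⟨0, fun ζ h => (Set.notMem_empty ζ h).elim⟩
  · rintro G ζ _ _ ⟨M, hM⟩
    obtain ⟨N, hN⟩ := ζ.exists_normLE
    refine ⟨max M N, ?_⟩
    rintro θ (rfl | hθ)
    · exact hN.mono (le_max_right _ _)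
    · exact (hM θ hθ).mono (le_max_left _ _)

theorem compactOps_subset_boundedOps : compactOps X R ⊆ boundedOps X R := by
  intro T hT
  obtain ⟨F, hF, h⟩ := mem_compactOps_iff.1 hT 1 1 one_pos
  obtain ⟨M, hM⟩ := exists_normLE_of_isFin hF
  have h1 : ∀ η : L2 X R, NormLE η 1 → NormLE (T η) (1 + M) := fun η hη => by
    obtain ⟨ζ, hζ, h'⟩ := h η hη
    have := h'.add (hM ζ hζ)
    simpa using this
  -- The bound `M` may come from an empty net a priori; the image of the zero vector shows that `1 +
  -- M` is nonnegative.
  have hM0 : 0 ≤ 1 + M := (h1 L2.zero (normLE_zero zero_le_one fun _ => rfl)).1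
  refine ⟨1 + M, hM0, fun η c hc => ?_⟩
  rcases hc.1.eq_or_lt with rfl | hpos
  · have h0 : ∀ x, η x = 0 := SqSumLE.eq_zero (by simpa using hc.2)
    exact normLE_zero (by simp) (T.map_zero h0)
  · have hz : ∀ r : El R, absSq (⟨r, 0⟩ : Cplx R) ≤ r ^ 2 := fun r => by simp [absSq]
    set η' := L2.lin ⟨c⁻¹, 0⟩ η L2.zero with hη'
    have h2 : NormLE η' 1 := by
      have := hc.mul (z := ⟨c⁻¹, 0⟩) (inv_nonneg.2 hc.1) (hz _)
      rw [inv_mul_cancel₀ hpos.ne'] at this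
      convert! this using 2 with x
      exact add_zero _
    have h3 := (h1 η' h2).mul (z := ⟨c, 0⟩) hc.1 (hz _)
    rw [mul_comm c] at h3
    convert! h3 using 2 with x
    have hcc : (⟨c, 0⟩ * ⟨c⁻¹, 0⟩ : Cplx R) = 1 := by
      ext <;> simp [hpos.ne'] <;> rfl
    refine Eq.trans ?_ (congrArg (⟨c, 0⟩ * ·) (T.map_lin ⟨c⁻¹, 0⟩ η L2.zero x)).symm
    rw [T.map_zero (η := L2.zero) (fun _ => rfl), add_zero, ← mul_assoc, hcc, one_mul]

theorem id_notMem_compactOps (hX : IsAmorphous X) : (Op.id : Op X R) ∉ compactOps X R := by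
  intro h
  have h4 : (0 : El R) < 1 / 4 := by norm_num
  obtain ⟨F, hF, h⟩ := mem_compactOps_iff.1 h 1 (1 / 4) h4
  refine hX.1 ?_
  have : Pred fun p : L2 X R × El X =>
      NormLE (fun w => (L2.single p.2 (1 : Cplx R)).toIFun.1 w - p.1.toIFun.1 w) (1 / 4 : El R) :=
    inferInstance
  -- A ball of radius `1/4` contains at most one basis vector: its centre would have to be within
  -- `1/4` of both `1` and `0` in the same coordinate. A finite net would therefore make `X` finite.
  have hQ := hF.biUnion (Q := fun (ζ : L2 X R) (x : El X) =>
    NormLE (fun w => (L2.single x (1 : Cplx R)).toIFun.1 w - ζ.toIFun.1 w) (1 / 4 : El R)) fun ζ _ => ?_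
  · convert! hQ using 1
    ext x
    simp only [Set.mem_univ, Set.mem_ofPred_eq, true_iff]
    exact h (L2.single x 1) (normLE_single zero_le_one (by rw [absSq_one]; simp))
  · by_cases hne : ∃ x : El X, NormLE (fun w => (L2.single x (1 : Cplx R)).toIFun.1 w - ζ.toIFun.1 w) (1 / 4 : El R)
    · obtain ⟨x, hx⟩ := hne
      refine (IsFin.singleton x).subset fun y hy => ?_
      by_contra hyx
      have h1 := hx.apply_le x
      have h2 := NormLE.apply_le hy x
      rw [L2.single_self] at h1
      rw [L2.single_of_ne (Ne.symm hyx), zero_sub, absSq_neg] at h2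
      have h1' : (1 - (ζ x).re) ^ 2 + (0 - (ζ x).im) ^ 2 ≤ (1 / 4) ^ 2 := h1
      have h2' : (ζ x).re ^ 2 + (ζ x).im ^ 2 ≤ (1 / 4) ^ 2 := h2
      nlinarith [sq_nonneg ((ζ x).im), sq_nonneg ((ζ x).re - 1 / 2)]
    · exact IsFin.empty.subset fun x hx => hne ⟨x, hx⟩

theorem IsStronglyAmorphous.boundedOps_eq (hX : IsStronglyAmorphous X) :
    boundedOps X R = compactAddScalar X R := by
  refine Set.Subset.antisymm (fun T hT => ?_) ?_
  · obtain ⟨F, c, hF, hTF⟩ := hX.exists_hasForm hT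
    refine ⟨_, hTF.sub_scalar.mem_compactOps hX.1 hF, c, fun η x => ?_⟩
    simp only [Op.lin_apply, Op.id_apply]
    ring
  · rintro T ⟨K, hK, c, h⟩
    have := lin_mem_boundedOps id_mem_boundedOps (compactOps_subset_boundedOps hK) c
    rwa [show T = Op.lin c Op.id K from Op.ext fun η x => by
      rw [h, Op.lin_apply, Op.id_apply, add_comm]]

theorem IsStronglyAmorphous.calkinOneDimensional (hX : IsStronglyAmorphous X) :
    CalkinOneDimensional X R := by
  have hself : ∀ T : Op X R, T ∈ coset T := fun T =>
    ⟨Op.zero, zero_mem_compactOps, fun η x => (add_zero (T η x)).symm⟩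
  refine ⟨⟨coset Op.id, Op.id, id_mem_boundedOps, rfl⟩, fun h => ?_, ?_⟩
  · exact id_notMem_compactOps hX.1 (R := R) (h ▸ hself Op.id)
  · rintro ⟨_, T, hT, rfl⟩
    rw [hX.boundedOps_eq] at hT
    obtain ⟨K, hK, c, h⟩ := hT
    -- For `T = K + c1` the representative `c1 = T - K` of the coset of `T` is exactly `c` times the
    -- representative `1` of the unit.
    refine ⟨c, Op.id, hself _, Op.lin c Op.id Op.zero,
      ⟨Op.lin (-1) K Op.zero, lin_mem_compactOps hK zero_mem_compactOps _, fun η x => ?_⟩,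
      fun η x => add_zero _⟩
    simp only [Op.lin_apply, Op.id_apply, Op.zero_apply, L2.zero_apply, h]
    ring

end Compact

section AF

variable {V : Type*} [Membership V V] [ZF V]
variable {X R : V} [Field (El R)] [LinearOrder (El R)] [IsStrictOrderedRing (El R)]
variable [hR : Fact (IsRealField R)]

/-! ### The AF structure -/

theorem isCStarSubalgebra_boundedOps (hX : IsStronglyAmorphous X) :
    IsCStarSubalgebra (boundedOps X R) where
  bounded := subset_rfl
  subspace := ⟨⟨Op.zero, zero_mem_boundedOps, fun _ _ => rfl⟩, fun S hS T hT c =>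
    ⟨Op.lin c S T, lin_mem_boundedOps hS hT c, fun _ _ => rfl⟩⟩
  mul S hS T hT := ⟨S.comp T, comp_mem_boundedOps hS hT, fun _ => rfl⟩
  adjoint S hS := by
    obtain ⟨F, c, hF, hSF⟩ := hX.exists_hasForm hS
    obtain ⟨T, hT, h⟩ := hSF.exists_isAdjoint hX.1 hF
    exact ⟨T, hT.mem_boundedOps hX.1 hF, h⟩
  closed T hT _ := hT

theorem eq_zero_of_absSq_le {z : Cplx R} (h : ∀ ε : El R, 0 < ε → absSq z ≤ 4 * ε ^ 2) : z = 0 := by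
  by_contra hz
  have hs := absSq_pos hz
  -- With `s = |z|²` this `ε` has `4 ε² = s² / (1 + s)²`, which is less than `s`.
  have := h (absSq z / (2 * (1 + absSq z))) (by positivity)
  rw [div_pow, mul_div_assoc', le_div_iff₀ (by positivity)] at this
  nlinarith [mul_pos hs hs, mul_pos hs (mul_pos hs hs)]

/-- Matrix entries depend continuously on the operator. The scalar of an approximant is its diagonal
entry at any point `w` outside `F`, so the entry of `T` at `w` is the limiting scalar. -/
theorem IsAmorphous.hasForm_of_approx (hX : IsAmorphous X) {F : ISet (El X)} (hF : IsFin F.set)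
    {T : Op X R} (h : ∀ ε : El R, 0 < ε → ∃ S : Op X R, (∃ c, HasForm S F c) ∧
      OpNormLE (fun η x => T η x - S η x) ε) : ∃ c, HasForm T F c := by
  obtain ⟨w, hw⟩ : ∃ w, w ∉ F.set := by
    by_contra! h
    exact hX.1 (hF.subset fun x _ => h x)
  refine ⟨T.entry w w, hX.hasForm fun x y hxy => ?_⟩
  refine sub_eq_zero.1 (eq_zero_of_absSq_le fun ε hε => ?_)
  obtain ⟨S, ⟨c, hS⟩, hTS⟩ := h ε hε
  have hentry (u v : El X) : absSq (T.entry u v - S.entry u v) ≤ ε ^ 2 := by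
    have := (hTS.2 (L2.single v 1) 1
      (normLE_single zero_le_one (by rw [absSq_one, one_pow]))).apply_le u
    rwa [mul_one] at this
  have h1 := hentry x y
  have h2 := hentry w w
  rw [hS.entry hxy] at h1
  rw [hS.entry (.inl hw), L2.single_self, mul_one] at h2
  by_cases hyx : x = y
  · subst hyx
    rw [L2.single_self, mul_one] at h1 ⊢
    -- With `t = 1` the two errors of size `ε²` combine to `4 ε²`.
    have h3 := absSq_add_le (z := T.entry x x - c) (w := -(T.entry w w - c)) one_pos
    rw [absSq_neg] at h3
    rw [show T.entry x x - T.entry w w = T.entry x x - c + -(T.entry w w - c) by ring]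
    refine h3.trans ?_
    rw [inv_one]
    linarith
  · rw [L2.single_of_ne hyx, mul_zero] at h1 ⊢
    have := sq_nonneg ε
    linarith

theorem isCStarSubalgebra_hasForm (hX : IsAmorphous X) {F : ISet (El X)} (hF : IsFin F.set)
    {A : ISet (Op X R)} (hA : ∀ T, T ∈ A.set ↔ ∃ c, HasForm T F c) : IsCStarSubalgebra A.set where
  bounded T hT := by
    obtain ⟨c, hT⟩ := (hA T).1 hT
    exact hT.mem_boundedOps hX hF
  subspace := by
    refine ⟨⟨Op.zero, (hA _).2 ⟨0, hasForm_zero F⟩, fun _ _ => rfl⟩, fun S hS T hT c => ?_⟩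
    obtain ⟨a, hS⟩ := (hA S).1 hS
    obtain ⟨b, hT⟩ := (hA T).1 hT
    exact ⟨Op.lin c S T, (hA _).2 ⟨_, hS.lin hT c⟩, fun _ _ => rfl⟩
  mul S hS T hT := by
    obtain ⟨a, hS⟩ := (hA S).1 hS
    obtain ⟨b, hT⟩ := (hA T).1 hT
    exact ⟨S.comp T, (hA _).2 ⟨_, hS.comp hT⟩, fun _ => rfl⟩
  adjoint S hS := by
    obtain ⟨a, hS⟩ := (hA S).1 hS
    obtain ⟨T, hT, h⟩ := hS.exists_isAdjoint hX hF
    exact ⟨T, (hA T).2 ⟨_, hT⟩, h⟩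
  closed T _ h := (hA T).2 <| hX.hasForm_of_approx hF fun ε hε => by
    obtain ⟨S, hS, hTS⟩ := h ε hε
    exact ⟨S, (hA S).1 hS, hTS⟩

theorem isFinDim_hasForm (hX : IsAmorphous X) {F : ISet (El X)} (hF : IsFin F.set)
    {A : ISet (Op X R)} (hA : ∀ T, T ∈ A.set ↔ ∃ c, HasForm T F c) : IsFinDim A.set := by
  -- The matrix units on `F × F` together with the identity span the algebra.
  refine ⟨{U | ∃ p ∈ {p : El X × El X | p.1 ∈ F.set ∧ p.2 ∈ F.set}, U = Op.unit p.1 p.2} ∪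
    {Op.id}, ?_, ((hF.prod hF).image fun p => (Op.unit p.1 p.2 : Op X R)).union (IsFin.singleton _), ?_⟩
  · rintro _ (⟨p, ⟨h1, h2⟩, rfl⟩ | rfl)
    · exact (hA _).2 ⟨0, hasForm_unit h1 h2⟩
    · exact (hA _).2 ⟨1, hasForm_id F⟩
  · rintro W hW ⟨⟨Z, hZ, hZ0⟩, hlin⟩ hGW T hT
    have hlin' : ∀ S ∈ W, ∀ T ∈ W, ∀ c : Cplx R, Op.lin c S T ∈ W := fun S hS T hT c => by
      obtain ⟨U, hU, h⟩ := hlin S hS T hT c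
      rwa [show Op.lin c S T = U from Op.ext fun η x => (h η x).symm]
    have hzero : Op.zero ∈ W := by
      rwa [show Op.zero = Z from Op.ext fun η x => (hZ0 η x).symm]
    obtain ⟨c, hT⟩ := (hA T).1 hT
    have := Pred.of_isSet hW
    have hK := hT.sub_scalar.induction hX hF (Φ := fun K => K ∈ W) hzero
      fun x hx y hy z K hK => hlin' _ (hGW (.inl ⟨(x, y), ⟨hx, hy⟩, rfl⟩)) _ hK z
    rw [← Op.scalar_add_sub_scalar c T]
    exact hlin' _ (hGW (.inr rfl)) _ hK c

theorem IsStronglyAmorphous.isAF (hX : IsStronglyAmorphous X) : IsAF (boundedOps X R) := by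
  let 𝒜 : ISet (ISet (Op X R)) := ISet.mk fun A => ∃ F : ISet (El X), IsFin F.set ∧
    ∀ T : Op X R, T ∈ A.set ↔ ∃ c, HasForm T F c
  refine ⟨isCStarSubalgebra_boundedOps hX, 𝒜.set, 𝒜.2, ?_, ?_, ?_, ?_⟩
  · exact ⟨ISet.mk fun T => ∃ c, HasForm T ISet.empty c, ISet.empty, IsFin.empty, fun _ => Iff.rfl⟩
  · rintro A ⟨F, hF, hA⟩
    have := isCStarSubalgebra_hasForm hX.1 hF hA
    exact ⟨this.bounded, this, isFinDim_hasForm hX.1 hF hA⟩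
  · rintro A ⟨F, hF, hA⟩ B ⟨G, hG, hB⟩
    obtain ⟨H, hH⟩ := (hF.union hG).exists_iSet
    refine ⟨ISet.mk fun T => ∃ c, HasForm T H c, ⟨H, hH ▸ hF.union hG, fun _ => Iff.rfl⟩,
      fun T hT => ?_, fun T hT => ?_⟩
    · obtain ⟨c, hT⟩ := (hA T).1 hT
      exact ⟨c, hT.mono (hH ▸ Set.subset_union_left)⟩
    · obtain ⟨c, hT⟩ := (hB T).1 hT
      exact ⟨c, hT.mono (hH ▸ Set.subset_union_right)⟩
  · intro T hT ε hε
    obtain ⟨F, c, hF, hTF⟩ := hX.exists_hasForm hT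
    -- No approximation is needed: `T` itself lies in one of the algebras.
    refine ⟨ISet.mk fun T => ∃ c, HasForm T F c, ⟨F, hF, fun _ => Iff.rfl⟩, T, ⟨c, hTF⟩, hε.le,
      fun η b hb => normLE_zero (mul_nonneg hε.le hb.1) fun _ => sub_self _⟩

end AF

end ZFModel

open ZFModel in
theorem propositionQ {V : Type*} [Membership V V] [ZF V]
    (R : V) [Field (El R)] [LinearOrder (El R)] [IsStrictOrderedRing (El R)] (hR : IsRealField R)
    (X : V) (hX : IsStronglyAmorphous X) :
    boundedOps X R = compactAddScalar X R ∧ CalkinOneDimensional X R ∧ IsAF (boundedOps X R) := by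
  have : Fact (IsRealField R) := ⟨hR⟩
  exact ⟨hX.boundedOps_eq, hX.calkinOneDimensional, hX.isAF⟩
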